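/- Let $n\ge 1$ and let $w:\mathbb R^n\to[0,\infty)$ be a measurable radial function. Let $\mathcal B(\mathbb C^n,w)$ be the weighted Bergman space of all entire functions $F$ on $\mathbb C^n$ with $$\int_{\mathbb R^n}\int_{\mathbb R^n}|F(x+iy)|^2\,w(y)\,dx\,dy<\infty .$$ Let $q\in L^1(\mathbb R^n)$ (complex valued) be such that the image of $L^2(\mathbb R^n)$ under the transform $T_qf(z)=f*q(z)$ is $\mathcal B(\mathbb C^n,w)$; that is, for every $f\in L^2(\mathbb R^n)$ the convolution $f*q$ agrees almost everywhere on $\mathbb R^n$ with the restriction of a (necessarily unique) entire function $T_qf\in\mathcal B(\mathbb C^n,w)$, and every element of $\mathcal B(\mathbb C^n,w)$ is of the form $T_qf$ with $f\in L^2(\mathbb R^n)$. Then $q*q$ also extends to an entire function on $\mathbb C^n$. Assume that its values $q*q(2iy)$, $y\in\mathbb R^n$, are real and nonnegative, so that $\sqrt{q*q(2iy)}$ makes sense. If $f\in L^2(\mathbb R^n)$ satisfies $$\int_{\mathbb R^n}|f*q(y)|\,\sqrt{q*q(2iy)}\,dy<\infty ,$$ then $f*q=0$ almost everywhere. Consequently,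 if $T_q$ is injective on $L^2(\mathbb R^n)$ (for instance if $\int_{\mathbb C^n}|T_qf(z)|^2w(y)\,dz=c\int_{\mathbb R^n}|f(x)|^2dx$ for all $f\in L^2(\mathbb R^n)$ and some constant $c>0$), there is no nontrivial $f\in L^2(\mathbb R^n)$ satisfying this condition. -/

import Mathlib

open MeasureTheory
open scoped ENNReal NNReal

noncomputable section

/-- The point `x + i y` of `ℂⁿ`, for `x, y` in `ℝⁿ`. -/
def complexPoint {n : ℕ} (x y : EuclideanSpace ℝ (Fin n)) : EuclideanSpace ℂ (Fin n) :=
  WithLp.toLp 2 fun j => (x j : ℂ) + (y j : ℂ) * Complex.I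

/-- The convolution `(f * q)(x) = ∫ f(t) q(x - t) dt` on `ℝⁿ`. -/
def fconv {n : ℕ} (f q : EuclideanSpace ℝ (Fin n) → ℂ) : EuclideanSpace ℝ (Fin n) → ℂ :=
  MeasureTheory.convolution f q (ContinuousLinearMap.mul ℂ ℂ) volume

/-- `G` is an entire function on `ℂⁿ` whose restriction to `ℝⁿ` is (a.e. equal to) `g`.
Such a `G` is unique; its value at `z` is what is meant by `g(z)`. -/
def IsEntireExtension {n : ℕ} (g : EuclideanSpace ℝ (Fin n) → ℂ)
    (G : EuclideanSpace ℂ (Fin n) → ℂ) : Prop :=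
  Differentiable ℂ G ∧ ∀ᵐ x : EuclideanSpace ℝ (Fin n), G (complexPoint x 0) = g x

/-- The weighted Bergman space `B(ℂⁿ, w)`: entire functions `F` with
`∫ |F(x + i y)|² w(y) dx dy < ∞`. -/
def weightedBergman {n : ℕ} (w : EuclideanSpace ℝ (Fin n) → ℝ≥0) :
    Set (EuclideanSpace ℂ (Fin n) → ℂ) :=
  {F | Differentiable ℂ F ∧
    ∫⁻ p : EuclideanSpace ℝ (Fin n) × EuclideanSpace ℝ (Fin n),
      ‖F (complexPoint p.1 p.2)‖ₑ ^ 2 * (w p.2 : ℝ≥0∞) < ∞}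

/-- `f ↦ f * q(z)` maps `L²(ℝⁿ)` into and onto `B(ℂⁿ, w)`. -/
def ImageIsBergman {n : ℕ} (q : EuclideanSpace ℝ (Fin n) → ℂ)
    (w : EuclideanSpace ℝ (Fin n) → ℝ≥0) : Prop :=
  (∀ f : EuclideanSpace ℝ (Fin n) → ℂ, MemLp f 2 volume →
    ∃ F ∈ weightedBergman w, IsEntireExtension (fconv f q) F) ∧
  (∀ F ∈ weightedBergman w,
    ∃ f : EuclideanSpace ℝ (Fin n) → ℂ, MemLp f 2 volume ∧ IsEntireExtension (fconv f q) F)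

/-- `f ↦ f * q` is injective on `L²(ℝⁿ)`. -/
def TransformInjective {n : ℕ} (q : EuclideanSpace ℝ (Fin n) → ℂ) : Prop :=
  ∀ f g : EuclideanSpace ℝ (Fin n) → ℂ, MemLp f 2 volume → MemLp g 2 volume →
    fconv f q =ᵐ[volume] fconv g q → f =ᵐ[volume] g

end

/-! ### L¹ and L² Fourier transforms compared by duality -/

section FourierPreliminaries

open FourierTransform SchwartzMap

variable {V : Type*} [NormedAddCommGroup V] [InnerProductSpace ℝ V] [FiniteDimensional ℝ V]
  [MeasurableSpace V] [BorelSpace V]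

/-! Write q̂ for `𝓕 q`. On the Fourier side f * q becomes φ q̂ with φ = f̂, and its entire extension
F is the Fourier–Laplace integral of φ q̂. That integral makes sense because point evaluations are
bounded (closed graph theorem), so the Riesz representation puts q̂(ξ) exp(2πi ξ·z) in L² for every
z (`memLp_fourier_mul_planeWave`).

Let E(y) = ∫ |q̂(ξ)|² exp(-4π ξ·y) dξ. Cauchy–Schwarz gives |F(x + iy)| ≤ A √E(y). The weight in the
hypothesis is √E, because q̂² = |q̂|² (`ImageIsBergman.fourier_mul_self_eq`). Indeed, q * q being
real on iℝⁿ makes q̂² real. Moreover {q̂ ≠ 0} is the interior of the convex set where W(ξ) = ∫ w(y)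
exp(-4π y·ξ) dy is finite, hence connected, so q̂² has one sign, and q * q(0) ≥ 0 decides which.
Evenness of w yields |q̂(-ξ)| ≤ C |q̂(ξ)|, so that E(by) ≤ C' E(y) for |b| ≤ 1.

Consequently |F(ζx)| is at most a constant times √E(x) for |Im ζ| < 1, and Φ(ζ) = ∫ F(ζx) conj F(x)
dx is bounded and holomorphic in that strip. Scaling x gives Φ(1/t) = |t|ⁿ conj Φ(t) for real t ≠ 0.
By this reflection Φ² continues to a bounded entire function tending to 0 along the imaginary axis,
which vanishes by Liouville (`eq_zero_of_strip_reflection`). Hence ∫ |F(x)|² dx = Φ(1) = 0. -/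

theorem ae_eq_of_integral_schwartz_mul_eq {f g : V → ℂ} (hf : LocallyIntegrable f volume)
    (hg : LocallyIntegrable g volume)
    (h : ∀ ψ : 𝓢(V, ℂ), ∫ x, ψ x * f x = ∫ x, ψ x * g x) : f =ᵐ[volume] g := by
  refine ae_eq_of_integral_contDiff_smul_eq hf hg fun u hu hu' => ?_
  have h₁ : HasCompactSupport (Complex.ofRealCLM ∘ u) := hu'.comp_left rfl
  have h₂ : ContDiff ℝ ((⊤ : ℕ∞) : WithTop ℕ∞) (Complex.ofRealCLM ∘ u) := by fun_prop
  simpa using h (h₁.toSchwartzMap h₂)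

theorem integral_fourier_mul_eq_flip {f g : V → ℂ} (hf : Integrable f volume)
    (hg : Integrable g volume) : ∫ x, 𝓕 f x * g x = ∫ x, f x * 𝓕 g x := by
  have := VectorFourier.integral_fourierIntegral_smul_eq_flip (μ := (volume : Measure V))
    (ν := (volume : Measure V)) (L := innerₗ V) (f := f) (g := g) Real.continuous_fourierChar
    (by simpa using continuous_inner) hf hg
  simp only [flip_innerₗ, smul_eq_mul] at this
  exact this

theorem integral_fourierInv_mul_eq_flip {f g : V → ℂ} (hf : Integrable f volume)
    (hg : Integrable g volume) : ∫ x, 𝓕⁻ f x * g x = ∫ x, f x * 𝓕⁻ g x := by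
  simp_rw [Real.fourierInv_eq_fourier_comp_neg]
  rw [integral_fourier_mul_eq_flip hf.comp_neg hg, ← integral_neg_eq_self]
  simp [← Real.fourierInv_eq_fourier_comp_neg, Real.fourierInv_eq_fourier_neg]

theorem integral_schwartz_mul_fourierInv_Lp (φ : Lp ℂ 2 (volume : Measure V)) (ψ : 𝓢(V, ℂ)) :
    ∫ x, ψ x * (𝓕⁻ φ : Lp ℂ 2 (volume : Measure V)) x = ∫ x, (𝓕⁻ ψ) x * φ x := by
  have := congrArg (fun T : 𝓢'(V, ℂ) => T ψ) (Lp.fourierInv_toTemperedDistribution_eq φ)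
  simpa using this.symm

theorem continuous_fourier_of_integrable {f : V → ℂ} (hf : Integrable f volume) :
    Continuous (𝓕 f) :=
  VectorFourier.fourierIntegral_continuous Real.continuous_fourierChar
    (by simpa using continuous_inner) hf

theorem continuous_fourierInv_of_integrable {f : V → ℂ} (hf : Integrable f volume) :
    Continuous (𝓕⁻ f) := by
  rw [Real.fourierInv_eq_fourier_comp_neg]
  exact continuous_fourier_of_integrable hf.comp_neg

theorem Continuous.memLp_indicator_closedBall {f : V → ℂ} (hf : Continuous f) (p : ℝ≥0∞)
    (x : V) (R : ℝ) : MemLp ((Metric.closedBall x R).indicator f) p volume := by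
  rw [memLp_indicator_iff_restrict Metric.isClosed_closedBall.measurableSet]
  obtain ⟨C, hC⟩ := (isCompact_closedBall x R).exists_bound_of_continuousOn hf.continuousOn
  have : IsFiniteMeasure (volume.restrict (Metric.closedBall x R)) :=
    ⟨by simpa using measure_closedBall_lt_top⟩
  refine MemLp.of_bound hf.aestronglyMeasurable C ?_
  rw [ae_restrict_iff' Metric.isClosed_closedBall.measurableSet]
  exact .of_forall hC

theorem MeasureTheory.MemLp.integrable_of_bounded_support {f : V → ℂ} (hf : MemLp f 2 volume)
    {R : ℝ} (hR : ∀ x, R < ‖x‖ → f x = 0) : Integrable f volume := by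
  have h1 : f = (Metric.closedBall (0 : V) R).indicator f := by
    funext x
    by_cases hx : ‖x‖ ≤ R
    · rw [Set.indicator_of_mem (by simpa using hx)]
    · rw [Set.indicator_of_notMem (by simpa using hx), hR x (not_le.1 hx)]
  have : IsFiniteMeasure (volume.restrict (Metric.closedBall (0 : V) R)) :=
    ⟨by simpa using measure_closedBall_lt_top⟩
  rw [h1, integrable_indicator_iff Metric.isClosed_closedBall.measurableSet]
  exact (hf.restrict _).integrable (by norm_num)

theorem MeasureTheory.MemLp.mul_continuous_of_bounded_support {f g : V → ℂ}
    (hf : MemLp f 2 volume) {R : ℝ} (hR : ∀ x, R < ‖x‖ → f x = 0) (hg : Continuous g) :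
    MemLp (fun x => f x * g x) 2 volume := by
  have h1 : (fun x => f x * g x) =
      fun x => f x * (Metric.closedBall (0 : V) R).indicator g x := by
    funext x
    by_cases hx : ‖x‖ ≤ R
    · rw [Set.indicator_of_mem (by simpa using hx)]
    · rw [hR x (not_le.1 hx), zero_mul, zero_mul]
  rw [h1]
  exact (hg.memLp_indicator_closedBall ∞ 0 R).mul hf

theorem fourierInv_toLp_ae_eq {φ : V → ℂ} (h1 : Integrable φ volume) (h2 : MemLp φ 2 volume) :
    (𝓕⁻ (h2.toLp φ) : Lp ℂ 2 (volume : Measure V)) =ᵐ[volume] 𝓕⁻ φ := by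
  have hc := continuous_fourierInv_of_integrable h1
  refine ae_eq_of_integral_schwartz_mul_eq
    ((Lp.memLp (𝓕⁻ (h2.toLp _) : Lp ℂ 2 (volume : Measure V))).locallyIntegrable (by norm_num)) hc.locallyIntegrable fun ψ => ?_
  rw [integral_schwartz_mul_fourierInv_Lp]
  have h3 : ∫ x, (𝓕⁻ ψ) x * (h2.toLp φ) x = ∫ x, (𝓕⁻ ψ) x * φ x := by
    refine integral_congr_ae ?_
    filter_upwards [h2.coeFn_toLp] with x hx
    rw [hx]
  rw [h3, SchwartzMap.fourierInv_coe, integral_fourierInv_mul_eq_flip (ψ.integrable (μ := volume)) h1]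

/-- Allows q itself to be inserted for f in f * q, although only q ∈ L¹ is given. -/
theorem ae_eq_fourierInv_toLp_fourier {q : V → ℂ} (h1 : Integrable q volume)
    (h2 : MemLp (𝓕 q) 2 volume) :
    q =ᵐ[volume] (𝓕⁻ (h2.toLp (𝓕 q)) : Lp ℂ 2 (volume : Measure V)) := by
  refine ae_eq_of_integral_schwartz_mul_eq h1.locallyIntegrable
    ((Lp.memLp (𝓕⁻ (h2.toLp _) : Lp ℂ 2 (volume : Measure V))).locallyIntegrable (by norm_num)) fun ψ => ?_
  rw [integral_schwartz_mul_fourierInv_Lp]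
  have h3 : ∫ x, (𝓕⁻ ψ) x * (h2.toLp (𝓕 q)) x = ∫ x, (𝓕⁻ ψ) x * 𝓕 q x := by
    refine integral_congr_ae ?_
    filter_upwards [h2.coeFn_toLp] with x hx
    rw [hx]
  rw [h3, ← integral_fourier_mul_eq_flip ((𝓕⁻ ψ).integrable (μ := volume)) h1, ← SchwartzMap.fourier_coe]
  simp

/-- Every Schwartz ψ is the inverse transform of `𝓕 ψ`, so the pairing of ψ with u depends only on
`𝓕⁻ u`. -/
theorem ae_eq_of_fourierInv_eq {f g : V → ℂ} (hf : Integrable f volume)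
    (hg : Integrable g volume) (h : 𝓕⁻ f = 𝓕⁻ g) : f =ᵐ[volume] g := by
  refine ae_eq_of_integral_schwartz_mul_eq hf.locallyIntegrable hg.locallyIntegrable fun ψ => ?_
  have key : ∀ u : V → ℂ, Integrable u volume → ∫ x, ψ x * u x = ∫ x, (𝓕 ψ) x * 𝓕⁻ u x := by
    intro u hu
    rw [← integral_fourierInv_mul_eq_flip ((𝓕 ψ).integrable (μ := volume)) hu, ← SchwartzMap.fourierInv_coe]
    simp
  rw [key f hf, key g hg, h]

end FourierPreliminaries

/-! ### Real points of ℂⁿ as a uniqueness set -/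

section ComplexPoint

open Filter Topology Complex

variable {n : ℕ}

theorem complexPoint_apply (x y : EuclideanSpace ℝ (Fin n)) (j : Fin n) :
    complexPoint x y j = (x j : ℂ) + (y j : ℂ) * I := rfl

theorem exists_complexPoint_eq (z : EuclideanSpace ℂ (Fin n)) :
    ∃ x y : EuclideanSpace ℝ (Fin n), complexPoint x y = z := by
  refine ⟨WithLp.toLp 2 fun j => (z j).re, WithLp.toLp 2 fun j => (z j).im, ?_⟩
  ext j
  simp [complexPoint_apply, re_add_im]

theorem continuous_complexPoint :
    Continuous fun p : EuclideanSpace ℝ (Fin n) × EuclideanSpace ℝ (Fin n) =>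
      complexPoint p.1 p.2 := by
  unfold complexPoint
  fun_prop

theorem continuous_complexPoint_zero_right :
    Continuous fun x : EuclideanSpace ℝ (Fin n) => complexPoint x 0 :=
  continuous_complexPoint.comp (by fun_prop : Continuous fun x => (x, (0 : EuclideanSpace ℝ (Fin n))))

theorem norm_complexPoint_sq (x y : EuclideanSpace ℝ (Fin n)) :
    ‖complexPoint x y‖ ^ 2 = ‖x‖ ^ 2 + ‖y‖ ^ 2 := by
  simp only [EuclideanSpace.norm_sq_eq, complexPoint_apply, ← Finset.sum_add_distrib]
  refine Finset.sum_congr rfl fun j _ => ?_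
  rw [← Complex.normSq_eq_norm_sq]
  simp [Complex.normSq_apply, ← sq]

theorem norm_complexPoint_zero_right (x : EuclideanSpace ℝ (Fin n)) :
    ‖complexPoint x 0‖ = ‖x‖ := by
  have := norm_complexPoint_sq x 0
  simpa using this

theorem norm_re_le_norm_complexPoint (x y : EuclideanSpace ℝ (Fin n)) :
    ‖x‖ ≤ ‖complexPoint x y‖ := by
  have := norm_complexPoint_sq x y
  exact le_of_sq_le_sq (by nlinarith [sq_nonneg ‖y‖]) (norm_nonneg _)

theorem complexPoint_line (x y : EuclideanSpace ℝ (Fin n)) (ζ : ℂ) :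
    complexPoint x 0 + ζ • complexPoint y 0 = complexPoint (x + ζ.re • y) (ζ.im • y) := by
  ext j
  apply Complex.ext <;> simp [complexPoint_apply]

theorem smul_complexPoint_zero_right (y : EuclideanSpace ℝ (Fin n)) (ζ : ℂ) :
    ζ • complexPoint y 0 = complexPoint (ζ.re • y) (ζ.im • y) := by
  ext j
  apply Complex.ext <;> simp [complexPoint_apply]

theorem neg_complexPoint (x y : EuclideanSpace ℝ (Fin n)) :
    -complexPoint x y = complexPoint (-x) (-y) := by
  ext j
  simp [complexPoint_apply]
  ring

theorem frequently_of_eventually_ofReal {P : ℂ → Prop} {t : ℝ}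
    (h : ∀ᶠ s : ℝ in 𝓝 t, P s) : ∃ᶠ ζ in 𝓝[≠] (t : ℂ), P ζ := by
  have hT : Tendsto (fun s : ℝ => (s : ℂ)) (𝓝[≠] t) (𝓝[≠] (t : ℂ)) := by
    refine tendsto_nhdsWithin_iff.2
      ⟨(Complex.continuous_ofReal.tendsto t).mono_left nhdsWithin_le_nhds, ?_⟩
    filter_upwards [self_mem_nhdsWithin] with s hs
    simpa using hs
  exact hT.frequently (h.filter_mono nhdsWithin_le_nhds).frequently

/-- A function on a ball of `ℂⁿ`, continuous and holomorphic along complexified real lines, that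
vanishes almost everywhere on the real points of the ball is zero. -/
theorem eq_zero_of_ae_real_eq_zero {R : ℝ} {H : EuclideanSpace ℂ (Fin n) → ℂ}
    (hH : ContinuousOn H (Metric.ball 0 R))
    (hline : ∀ x y : EuclideanSpace ℝ (Fin n),
      DifferentiableOn ℂ (fun ζ : ℂ => H (complexPoint x 0 + ζ • complexPoint y 0))
        {ζ : ℂ | complexPoint x 0 + ζ • complexPoint y 0 ∈ Metric.ball 0 R})
    (h0 : ∀ᵐ x : EuclideanSpace ℝ (Fin n), ‖x‖ < R → H (complexPoint x 0) = 0) :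
    ∀ z ∈ Metric.ball 0 R, H z = 0 := by
  have hreal : ∀ x : EuclideanSpace ℝ (Fin n), ‖x‖ < R → H (complexPoint x 0) = 0 := by
    have hc : ContinuousOn (fun x => H (complexPoint x 0))
        (Metric.ball (0 : EuclideanSpace ℝ (Fin n)) R) :=
      hH.comp continuous_complexPoint_zero_right.continuousOn
        fun x hx => by simpa [norm_complexPoint_zero_right] using hx
    have := Measure.eqOn_open_of_ae_eq (μ := (volume : Measure (EuclideanSpace ℝ (Fin n))))
      (g := fun _ => (0 : ℂ)) (by
        rw [EventuallyEq, ae_restrict_iff' Metric.isOpen_ball.measurableSet]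
        filter_upwards [h0] with x hx hx'
        exact hx (by simpa using hx')) Metric.isOpen_ball hc continuousOn_const
    exact fun x hx => this (by simpa using hx)
  intro z hz
  obtain ⟨x, y, rfl⟩ := exists_complexPoint_eq z
  -- This complex line is real for real ζ and reaches x + iy at ζ = I. Its trace in the ball is
  -- convex, hence connected, so the one-variable identity theorem carries the zeros near ζ = 0 on
  -- the real axis to ζ = I.
  let A : ℂ → EuclideanSpace ℂ (Fin n) := fun ζ => complexPoint x 0 + ζ • complexPoint y 0
  have hA : Differentiable ℂ A := by fun_prop
  have hopen : IsOpen (A ⁻¹' Metric.ball 0 R) := Metric.isOpen_ball.preimage hA.continuous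
  have hconv : Convex ℝ (A ⁻¹' Metric.ball 0 R) := by
    intro ζ hζ ζ' hζ' a b ha hb hab
    have hA' : A (a • ζ + b • ζ') = a • A ζ + b • A ζ' := by
      have h1 : (complexPoint x 0 : EuclideanSpace ℂ (Fin n)) =
          a • complexPoint x 0 + b • complexPoint x 0 := by rw [← add_smul, hab, one_smul]
      simp only [A, smul_add, add_smul, smul_assoc]
      nth_rw 1 [h1]
      abel
    rw [Set.mem_preimage, hA']
    exact convex_ball (0 : EuclideanSpace ℂ (Fin n)) R hζ hζ' ha hb hab
  have hmem0 : (0 : ℂ) ∈ A ⁻¹' Metric.ball 0 R := by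
    have := norm_re_le_norm_complexPoint x y
    simp only [Metric.mem_ball, dist_zero_right] at hz
    simpa [A, norm_complexPoint_zero_right] using this.trans_lt hz
  have hmemI : I ∈ A ⁻¹' Metric.ball 0 R := by
    simpa [A, complexPoint_line] using hz
  have hd : DifferentiableOn ℂ (H ∘ A) (A ⁻¹' Metric.ball 0 R) :=
    hline x y
  have hfreq : ∃ᶠ ζ in 𝓝[≠] (0 : ℂ), (H ∘ A) ζ = 0 := by
    rw [← Complex.ofReal_zero]
    apply frequently_of_eventually_ofReal
    have : ∀ᶠ s : ℝ in 𝓝 0, (s : ℂ) ∈ A ⁻¹' Metric.ball 0 R :=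
      Complex.continuous_ofReal.tendsto 0 (hopen.mem_nhds (by simpa using hmem0))
    filter_upwards [this] with s hs
    simp only [A, complexPoint_line, Set.mem_preimage, ofReal_re, ofReal_im, zero_smul,
      Metric.mem_ball, dist_zero_right, norm_complexPoint_zero_right] at hs
    simp only [A, Function.comp, complexPoint_line, ofReal_re, ofReal_im, zero_smul]
    exact hreal _ hs
  have := (hd.analyticOnNhd hopen).eqOn_zero_of_preconnected_of_frequently_eq_zero
    hconv.isPreconnected hmem0 hfreq hmemI
  simpa [A, complexPoint_line] using this

theorem IsEntireExtension.unique {g : EuclideanSpace ℝ (Fin n) → ℂ}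
    {F G : EuclideanSpace ℂ (Fin n) → ℂ} (hF : IsEntireExtension g F)
    (hG : IsEntireExtension g G) : F = G := by
  funext z
  have := eq_zero_of_ae_real_eq_zero (R := ‖z‖ + 1) (H := fun z => F z - G z)
    (hF.1.sub hG.1).continuous.continuousOn
    (fun x y => ((hF.1.sub hG.1).comp (by fun_prop :
      Differentiable ℂ fun ζ : ℂ => complexPoint x 0 + ζ • complexPoint y 0)).differentiableOn) (by
      filter_upwards [hF.2, hG.2] with x hx hx' _
      rw [hx, hx', sub_self]) z (by simp)
  exact sub_eq_zero.1 this

theorem IsEntireExtension.congr {g g' : EuclideanSpace ℝ (Fin n) → ℂ}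
    {F : EuclideanSpace ℂ (Fin n) → ℂ} (hF : IsEntireExtension g F)
    (h : g =ᵐ[volume] g') : IsEntireExtension g' F :=
  ⟨hF.1, by filter_upwards [hF.2, h] with x hx hx'; rw [hx, hx']⟩

end ComplexPoint

/-! ### Fourier–Laplace integrals of compactly supported functions -/

section FourierLaplace

open Complex FourierTransform RealInnerProductSpace

variable {n : ℕ}

/-- The complex bilinear pairing `∑ ξⱼ zⱼ` of a real vector with a complex one. -/
noncomputable def complexDot (ξ : EuclideanSpace ℝ (Fin n)) : EuclideanSpace ℂ (Fin n) →L[ℂ] ℂ :=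
  innerSL ℂ (complexPoint ξ 0)

theorem norm_complexDot (ξ : EuclideanSpace ℝ (Fin n)) : ‖complexDot ξ‖ = ‖ξ‖ := by
  rw [complexDot, innerSL_apply_norm, norm_complexPoint_zero_right]

theorem complexDot_complexPoint (ξ x y : EuclideanSpace ℝ (Fin n)) :
    complexDot ξ (complexPoint x y) = (⟪ξ, x⟫ : ℂ) + (⟪ξ, y⟫ : ℂ) * I := by
  simp only [complexDot, innerSL_apply_apply, PiLp.inner_apply, complexPoint_apply, ofReal_sum,
    Finset.sum_mul, ← Finset.sum_add_distrib]
  refine Finset.sum_congr rfl fun j _ => ?_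
  simp
  ring

/-- The exponential `exp (2πi ∑ ξⱼ zⱼ)`. -/
noncomputable def planeWave (ξ : EuclideanSpace ℝ (Fin n)) (z : EuclideanSpace ℂ (Fin n)) : ℂ :=
  cexp (2 * Real.pi * I * complexDot ξ z)

theorem continuous_planeWave_left (z : EuclideanSpace ℂ (Fin n)) :
    Continuous fun ξ => planeWave ξ z := by
  have := continuous_complexPoint_zero_right (n := n)
  unfold planeWave complexDot
  simp only [innerSL_apply_apply]
  fun_prop

theorem norm_planeWave (ξ x y : EuclideanSpace ℝ (Fin n)) :
    ‖planeWave ξ (complexPoint x y)‖ = Real.exp (-(2 * Real.pi * ⟪ξ, y⟫)) := by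
  rw [planeWave, complexDot_complexPoint, Complex.norm_exp]
  congr 1
  simp

theorem norm_planeWave_le (ξ : EuclideanSpace ℝ (Fin n)) (z : EuclideanSpace ℂ (Fin n)) :
    ‖planeWave ξ z‖ ≤ Real.exp (2 * Real.pi * (‖ξ‖ * ‖z‖)) := by
  rw [planeWave, Complex.norm_exp, Real.exp_le_exp]
  refine (Complex.re_le_norm _).trans ?_
  rw [norm_mul]
  have h1 : ‖(2 * Real.pi * I : ℂ)‖ = 2 * Real.pi := by
    simp [abs_of_pos Real.pi_pos]
  rw [h1]
  have := (complexDot ξ).le_opNorm z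
  rw [norm_complexDot] at this
  gcongr

/-- The Fourier–Laplace transform `z ↦ ∫ h(ξ) exp (2πi ∑ ξⱼ zⱼ) dξ`. -/
noncomputable def fourierLaplace (h : EuclideanSpace ℝ (Fin n) → ℂ)
    (z : EuclideanSpace ℂ (Fin n)) : ℂ :=
  ∫ ξ, h ξ * planeWave ξ z

theorem planeWave_add (ξ : EuclideanSpace ℝ (Fin n)) (z z' : EuclideanSpace ℂ (Fin n)) :
    planeWave ξ (z + z') = planeWave ξ z * planeWave ξ z' := by
  simp only [planeWave, map_add, mul_add, Complex.exp_add]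

theorem complexPoint_eq_add (x y : EuclideanSpace ℝ (Fin n)) :
    complexPoint x y = complexPoint 0 y + complexPoint x 0 := by
  ext j
  simp [complexPoint_apply, add_comm]

theorem fourierLaplace_complexPoint (h : EuclideanSpace ℝ (Fin n) → ℂ)
    (x y : EuclideanSpace ℝ (Fin n)) :
    fourierLaplace h (complexPoint x y) =
      𝓕⁻ (fun ξ => h ξ * planeWave ξ (complexPoint 0 y)) x := by
  rw [fourierLaplace, Real.fourierInv_eq']
  refine integral_congr_ae (.of_forall fun ξ => ?_)
  simp only [complexPoint_eq_add x y, planeWave_add, smul_eq_mul]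
  have : planeWave ξ (complexPoint x 0) = cexp (↑(2 * Real.pi * ⟪ξ, x⟫) * I) := by
    rw [planeWave, complexDot_complexPoint]
    congr 1
    push_cast
    simp
    ring
  rw [this]
  ring

theorem fourierLaplace_real (h : EuclideanSpace ℝ (Fin n) → ℂ)
    (x : EuclideanSpace ℝ (Fin n)) :
    fourierLaplace h (complexPoint x 0) = 𝓕⁻ h x := by
  rw [fourierLaplace_complexPoint]
  have : complexPoint (0 : EuclideanSpace ℝ (Fin n)) 0 = 0 := by
    ext j
    simp [complexPoint_apply]
  simp [this, planeWave]

theorem differentiable_fourierLaplace {h : EuclideanSpace ℝ (Fin n) → ℂ}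
    (hi : Integrable h volume) {R : ℝ} (hR : ∀ ξ, R < ‖ξ‖ → h ξ = 0) :
    Differentiable ℂ (fourierLaplace h) := by
  intro z₀
  have hmeas : ∀ z : EuclideanSpace ℂ (Fin n),
      AEStronglyMeasurable (fun ξ => h ξ * planeWave ξ z) volume := fun z =>
    hi.aestronglyMeasurable.mul (continuous_planeWave_left z).aestronglyMeasurable
  -- Where h is nonzero, ‖ξ‖ ≤ R, so the exponential is bounded uniformly for z near z₀. The
  -- absolute value covers negative R.
  have hbd : ∀ ξ : EuclideanSpace ℝ (Fin n), ∀ z ∈ Metric.ball z₀ 1,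
      ‖h ξ * planeWave ξ z‖ ≤ ‖h ξ‖ * Real.exp (2 * Real.pi * (|R| * (‖z₀‖ + 1))) := by
    intro ξ z hz
    by_cases hξ : R < ‖ξ‖
    · simp [hR ξ hξ]
    rw [norm_mul]
    have hz' : ‖z‖ ≤ ‖z₀‖ + 1 := by
      have h1 := norm_sub_norm_le z z₀
      rw [mem_ball_iff_norm] at hz
      linarith
    have hξ' : ‖ξ‖ ≤ |R| := (not_lt.1 hξ).trans (le_abs_self R)
    have := norm_planeWave_le ξ z
    have h2 : Real.exp (2 * Real.pi * (‖ξ‖ * ‖z‖)) ≤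
        Real.exp (2 * Real.pi * (|R| * (‖z₀‖ + 1))) := by gcongr
    exact mul_le_mul_of_nonneg_left (this.trans h2) (norm_nonneg _)
  have hdot : Continuous fun ξ : EuclideanSpace ℝ (Fin n) => complexDot ξ :=
    (innerSL ℂ).continuous.comp continuous_complexPoint_zero_right
  refine (hasFDerivAt_integral_of_dominated_of_fderiv_le (𝕜 := ℂ)
    (F := fun z ξ => h ξ * planeWave ξ z)
    (F' := fun z ξ => (h ξ * planeWave ξ z) • ((2 * Real.pi * I : ℂ) • complexDot ξ))
    (bound := fun ξ => ‖h ξ‖ * Real.exp (2 * Real.pi * (|R| * (‖z₀‖ + 1))) * (2 * Real.pi * |R|))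
    (s := Metric.ball z₀ 1) (Metric.ball_mem_nhds z₀ one_pos)
    (.of_forall hmeas) ?_ ?_ ?_ ?_ ?_).differentiableAt
  · exact (hi.norm.mul_const _).mono' (hmeas z₀)
      (.of_forall fun ξ => hbd ξ z₀ (Metric.mem_ball_self one_pos))
  · exact (hmeas z₀).smul (hdot.const_smul (2 * Real.pi * I : ℂ)).aestronglyMeasurable
  · refine .of_forall fun ξ z hz => ?_
    by_cases hξ : R < ‖ξ‖
    · simp [hR ξ hξ]
    have hξ' : ‖ξ‖ ≤ |R| := (not_lt.1 hξ).trans (le_abs_self R)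
    rw [norm_smul, norm_smul, norm_complexDot]
    have h1 : ‖(2 * Real.pi * I : ℂ)‖ = 2 * Real.pi := by
      simp [abs_of_pos Real.pi_pos]
    rw [h1]
    have := hbd ξ z hz
    gcongr
  · exact (hi.norm.mul_const _).mul_const _
  · refine .of_forall fun ξ z _ => ?_
    have h1 : HasFDerivAt (fun z => (2 * Real.pi * I : ℂ) * complexDot ξ z)
        ((2 * Real.pi * I : ℂ) • complexDot ξ) z := (complexDot ξ).hasFDerivAt.const_mul _
    have := (h1.cexp).const_mul (h ξ)
    rw [smul_smul] at this
    exact this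

theorem isEntireExtension_fourierLaplace {h : EuclideanSpace ℝ (Fin n) → ℂ}
    (hi : Integrable h volume) {R : ℝ} (hR : ∀ ξ, R < ‖ξ‖ → h ξ = 0) :
    IsEntireExtension (𝓕⁻ h) (fourierLaplace h) :=
  ⟨differentiable_fourierLaplace hi hR, .of_forall (fourierLaplace_real h)⟩

/-- Convolution becomes multiplication on the Fourier side. -/
theorem fconv_fourierInv {φ q : EuclideanSpace ℝ (Fin n) → ℂ} (hφ : Integrable φ volume)
    (hq : Integrable q volume) : fconv (𝓕⁻ φ) q = 𝓕⁻ (fun ξ => φ ξ * 𝓕 q ξ) := by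
  funext x
  have h1 : fconv (𝓕⁻ φ) q x = ∫ t, 𝓕⁻ φ t * q (x - t) := by
    simp [fconv, convolution_def]
  rw [h1, integral_fourierInv_mul_eq_flip hφ (hq.comp_sub_left x), Real.fourierInv_eq']
  refine integral_congr_ae (.of_forall fun ξ => ?_)
  simp only [smul_eq_mul]
  rw [mul_left_comm]
  congr 1
  rw [Real.fourierInv_eq', Real.fourier_eq', ← integral_const_mul,
    ← integral_sub_left_eq_self _ volume x]
  refine integral_congr_ae (.of_forall fun t => ?_)
  simp only [smul_eq_mul, sub_sub_cancel]
  rw [← mul_assoc, ← Complex.exp_add]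
  congr 2
  rw [inner_sub_left, real_inner_comm x ξ]
  push_cast
  ring

/-- Bounded support of φ makes the extension explicit before any decay of `𝓕 q` is known. -/
theorem isEntireExtension_fconv_fourierInv {φ q : EuclideanSpace ℝ (Fin n) → ℂ}
    (hφ : MemLp φ 2 volume) {R : ℝ} (hR : ∀ ξ, R < ‖ξ‖ → φ ξ = 0) (hq : Integrable q volume) :
    IsEntireExtension
      (fconv (𝓕⁻ (hφ.toLp φ) : Lp ℂ 2 (volume : Measure (EuclideanSpace ℝ (Fin n)))) q)
      (fourierLaplace fun ξ => φ ξ * 𝓕 q ξ) := by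
  have hi := hφ.integrable_of_bounded_support hR
  have h1 : fconv (𝓕⁻ (hφ.toLp φ) : Lp ℂ 2 (volume : Measure (EuclideanSpace ℝ (Fin n)))) q =
      fconv (𝓕⁻ φ) q := by
    funext x
    simp only [fconv, convolution_def]
    refine integral_congr_ae ?_
    filter_upwards [fourierInv_toLp_ae_eq hi hφ] with t ht
    rw [ht]
  have hR' : ∀ ξ, R < ‖ξ‖ → φ ξ * 𝓕 q ξ = 0 := fun ξ hξ => by rw [hR ξ hξ, zero_mul]
  rw [h1, fconv_fourierInv hi hq]
  exact isEntireExtension_fourierLaplace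
    ((hφ.mul_continuous_of_bounded_support hR
      (continuous_fourier_of_integrable hq)).integrable_of_bounded_support hR') hR'

end FourierLaplace

/-! ### Local L¹ bounds for L² * L¹ convolutions -/

section LocalConvolution

open Filter Topology

variable {n : ℕ}

/-- Tonelli, then Cauchy–Schwarz on K for each translate of f. For K of finite measure this yields
both a.e. convergence of the convolution integral and continuity of f ↦ f * q from L² to L¹(K). -/
theorem lintegral_convolution_integrand_le {f q : EuclideanSpace ℝ (Fin n) → ℂ}
    (hf : MemLp f 2 volume) (hq : Integrable q volume) (K : Set (EuclideanSpace ℝ (Fin n))) :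
    ∫⁻ x in K, ∫⁻ t, ‖q t * f (x - t)‖ₑ ≤
      (∫⁻ t, ‖q t‖ₑ) * (eLpNorm f 2 volume * volume K ^ (1 / 2 : ℝ)) := by
  have hmeas : AEStronglyMeasurable (fun p : EuclideanSpace ℝ (Fin n) × EuclideanSpace ℝ (Fin n) =>
      q p.2 * f (p.1 - p.2)) ((volume.restrict K).prod volume) :=
    (hq.aestronglyMeasurable.convolution_integrand (ContinuousLinearMap.mul ℂ ℂ)
      hf.aestronglyMeasurable).mono_measure (Measure.prod_mono Measure.restrict_le_self le_rfl)
  rw [lintegral_lintegral_swap hmeas.enorm]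
  have hin : ∀ t, ∫⁻ x in K, ‖q t * f (x - t)‖ₑ ≤
      ‖q t‖ₑ * (eLpNorm f 2 volume * volume K ^ (1 / 2 : ℝ)) := by
    intro t
    simp only [enorm_mul]
    rw [lintegral_const_mul' _ _ enorm_ne_top]
    gcongr
    have hmp := measurePreserving_sub_right (volume : Measure (EuclideanSpace ℝ (Fin n))) t
    have h1 : MemLp (fun x => f (x - t)) 2 volume := hf.comp_measurePreserving hmp
    have h2 := eLpNorm_le_eLpNorm_mul_rpow_measure_univ (p := 1) (q := 2) (by norm_num)
      (h1.aestronglyMeasurable.restrict (s := K))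
    rw [eLpNorm_one_eq_lintegral_enorm] at h2
    refine h2.trans ?_
    have h3 : eLpNorm (fun x => f (x - t)) 2 volume = eLpNorm f 2 volume :=
      eLpNorm_comp_measurePreserving hf.aestronglyMeasurable hmp
    rw [← h3]
    have h4 : (1 / (1 : ℝ≥0∞).toReal - 1 / (2 : ℝ≥0∞).toReal) = (1 / 2 : ℝ) := by norm_num
    rw [h4, Measure.restrict_apply_univ]
    gcongr
    exact Measure.restrict_le_self
  calc _ ≤ ∫⁻ t, ‖q t‖ₑ * (eLpNorm f 2 volume * volume K ^ (1 / 2 : ℝ)) := lintegral_mono hin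
    _ = _ := lintegral_mul_const'' _ hq.aestronglyMeasurable.enorm

theorem fconv_eq_integral_swap (f q : EuclideanSpace ℝ (Fin n) → ℂ) (x : EuclideanSpace ℝ (Fin n)) :
    fconv f q x = ∫ t, q t * f (x - t) := by
  simp [fconv, convolution_eq_swap, mul_comm]

theorem ae_integrable_convolution_integrand {f q : EuclideanSpace ℝ (Fin n) → ℂ}
    (hf : MemLp f 2 volume) (hq : Integrable q volume) :
    ∀ᵐ x, Integrable (fun t => q t * f (x - t)) volume := by
  refine ae_of_forall_measure_lt_top_ae_restrict _ fun K _ hKfin => ?_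
  have hmeas : AEStronglyMeasurable (fun p : EuclideanSpace ℝ (Fin n) × EuclideanSpace ℝ (Fin n) =>
      q p.2 * f (p.1 - p.2)) ((volume.restrict K).prod volume) :=
    (hq.aestronglyMeasurable.convolution_integrand (ContinuousLinearMap.mul ℂ ℂ)
      hf.aestronglyMeasurable).mono_measure (Measure.prod_mono Measure.restrict_le_self le_rfl)
  have hfin := (lintegral_convolution_integrand_le hf hq K).trans_lt
    (ENNReal.mul_lt_top hq.2 (ENNReal.mul_lt_top hf.2
      (ENNReal.rpow_lt_top_of_nonneg (by norm_num) hKfin.ne)))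
  filter_upwards [ae_lt_top' hmeas.enorm.lintegral_prod_right' hfin.ne,
    hmeas.prodMk_left] with x hx hx'
  exact ⟨hx', hx⟩

theorem lintegral_fconv_le {f q : EuclideanSpace ℝ (Fin n) → ℂ}
    (hf : MemLp f 2 volume) (hq : Integrable q volume) (K : Set (EuclideanSpace ℝ (Fin n))) :
    ∫⁻ x in K, ‖fconv f q x‖ₑ ≤
      (∫⁻ t, ‖q t‖ₑ) * (eLpNorm f 2 volume * volume K ^ (1 / 2 : ℝ)) := by
  refine (lintegral_mono fun x => ?_).trans (lintegral_convolution_integrand_le hf hq K)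
  rw [fconv_eq_integral_swap]
  exact enorm_integral_le_lintegral_enorm _

theorem fconv_congr_left {f g : EuclideanSpace ℝ (Fin n) → ℂ} (h : f =ᵐ[volume] g)
    (q : EuclideanSpace ℝ (Fin n) → ℂ) : fconv f q = fconv g q := by
  funext x
  simp only [fconv, convolution_def]
  refine integral_congr_ae ?_
  filter_upwards [h] with t ht
  rw [ht]

theorem fconv_add_left {f g q : EuclideanSpace ℝ (Fin n) → ℂ} (hf : MemLp f 2 volume)
    (hg : MemLp g 2 volume) (hq : Integrable q volume) :
    fconv (f + g) q =ᵐ[volume] fconv f q + fconv g q := by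
  filter_upwards [ae_integrable_convolution_integrand hf hq,
    ae_integrable_convolution_integrand hg hq] with x hx hx'
  simp only [Pi.add_apply, fconv_eq_integral_swap, mul_add]
  exact integral_add hx hx'

theorem fconv_smul_left (c : ℂ) (f q : EuclideanSpace ℝ (Fin n) → ℂ) :
    fconv (c • f) q = c • fconv f q := smul_convolution

theorem fconv_sub_left {f g q : EuclideanSpace ℝ (Fin n) → ℂ} (hf : MemLp f 2 volume)
    (hg : MemLp g 2 volume) (hq : Integrable q volume) :
    fconv (f - g) q =ᵐ[volume] fconv f q - fconv g q := by
  filter_upwards [ae_integrable_convolution_integrand hf hq,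
    ae_integrable_convolution_integrand hg hq] with x hx hx'
  simp only [Pi.sub_apply, fconv_eq_integral_swap, mul_sub]
  exact integral_sub hx hx'

end LocalConvolution

/-! ### Bounded point evaluations and decay of the Fourier transform -/

section PointEvaluation

open Filter Topology FourierTransform

variable {n : ℕ}

/-- The closed graph theorem makes evaluation of the entire extension of `φ * q` continuous in
`φ ∈ L²`, locally uniformly in the evaluation point. -/
theorem exists_norm_entireExtension_le {q : EuclideanSpace ℝ (Fin n) → ℂ}
    (hq : Integrable q volume)
    (hT : ∀ f : EuclideanSpace ℝ (Fin n) → ℂ, MemLp f 2 volume →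
      ∃ F, IsEntireExtension (fconv f q) F) (R : ℝ) :
    ∃ C : ℝ, ∀ φ : Lp ℂ 2 (volume : Measure (EuclideanSpace ℝ (Fin n))),
      ∀ F, IsEntireExtension (fconv φ q) F → ∀ z ∈ Metric.ball (0 : EuclideanSpace ℂ (Fin n)) R,
        ‖F z‖ ≤ C * ‖φ‖ := by
  rcases le_or_gt R 0 with hR | hR
  · exact ⟨0, fun φ F _ z hz => by simp [Metric.ball_eq_empty.2 hR] at hz⟩
  choose F hF using fun φ : Lp ℂ 2 (volume : Measure (EuclideanSpace ℝ (Fin n))) =>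
    hT φ (Lp.memLp φ)
  have hadd : ∀ φ ψ, F (φ + ψ) = F φ + F ψ := fun φ ψ => by
    refine (hF (φ + ψ)).unique ⟨(hF φ).1.add (hF ψ).1, ?_⟩
    rw [fconv_congr_left (Lp.coeFn_add φ ψ)]
    filter_upwards [(hF φ).2, (hF ψ).2, fconv_add_left (Lp.memLp φ) (Lp.memLp ψ) hq]
      with x h1 h2 h3
    rw [h3, Pi.add_apply, Pi.add_apply, h1, h2]
  have hsmul : ∀ (c : ℂ) φ, F (c • φ) = c • F φ := fun c φ => by
    refine (hF (c • φ)).unique ⟨(hF φ).1.const_smul c, ?_⟩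
    rw [fconv_congr_left (Lp.coeFn_smul c φ), fconv_smul_left]
    filter_upwards [(hF φ).2] with x h1
    rw [Pi.smul_apply, Pi.smul_apply, h1]
  let K : Set (EuclideanSpace ℂ (Fin n)) := Metric.closedBall 0 R
  have : CompactSpace K := isCompact_iff_compactSpace.1 (isCompact_closedBall _ _)
  let T : Lp ℂ 2 (volume : Measure (EuclideanSpace ℝ (Fin n))) →ₗ[ℂ] C(K, ℂ) :=
    { toFun := fun φ => ⟨fun z => F φ z, (hF φ).1.continuous.comp continuous_subtype_val⟩
      map_add' := fun φ ψ => by ext z; simp [hadd]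
      map_smul' := fun c φ => by ext z; simp [hsmul] }
  have hcont : Continuous T := by
    -- Suppose u j → φ in L² and the extensions converge to G uniformly on K. The limit is
    -- continuous, and holomorphic along complex lines inside the open ball, so it need only be
    -- compared with F φ at almost every real point.
    refine T.continuous_of_seq_closed_graph fun u φ G hu hG => ?_
    rw [ContinuousMap.tendsto_iff_tendstoUniformly] at hG
    let G' : EuclideanSpace ℂ (Fin n) → ℂ := Function.extend Subtype.val G 0
    have hG' : ∀ z : K, G' z = G z := fun z => Subtype.val_injective.extend_apply _ _ _
    have hunif : TendstoUniformlyOn (fun j => F (u j)) G' atTop K := by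
      rw [tendstoUniformlyOn_iff_tendstoUniformly_comp_coe]
      rw [show G' ∘ Subtype.val = G from funext hG']
      exact hG
    have hGc : ContinuousOn G' K :=
      hunif.continuousOn (.of_forall fun j => (hF (u j)).1.continuous.continuousOn)
    have hsub : Metric.ball (0 : EuclideanSpace ℂ (Fin n)) R ⊆ K := Metric.ball_subset_closedBall
    have hzero := eq_zero_of_ae_real_eq_zero (R := R) (H := fun z => G' z - F φ z)
      ((hGc.mono hsub).sub (hF φ).1.continuous.continuousOn)
      (fun x y => by
        have hA : Differentiable ℂ fun ζ : ℂ => complexPoint x 0 + ζ • complexPoint y 0 := by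
          fun_prop
        refine DifferentiableOn.sub ?_ ((hF φ).1.comp hA).differentiableOn
        refine TendstoLocallyUniformlyOn.differentiableOn (φ := atTop)
          (F := fun j ζ => F (u j) (complexPoint x 0 + ζ • complexPoint y 0))
          ?_ (.of_forall fun j => ((hF (u j)).1.comp hA).differentiableOn)
          (Metric.isOpen_ball.preimage hA.continuous)
        exact ((hunif.mono hsub).comp (fun ζ : ℂ => complexPoint x 0 + ζ • complexPoint y 0)).tendstoLocallyUniformlyOn)
      (by
        let b : Set (EuclideanSpace ℝ (Fin n)) := Metric.ball 0 R
        have hreal : ∀ x ∈ b, complexPoint x 0 ∈ K := fun x hx => by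
          have : ‖x‖ < R := by simpa [b] using hx
          simpa [K, norm_complexPoint_zero_right] using this.le
        have hcR : ∀ ψ, Continuous fun x => F ψ (complexPoint x 0) := fun ψ =>
          (hF ψ).1.continuous.comp continuous_complexPoint_zero_right
        -- Fatou's lemma together with the L¹(b) bound for (u j - φ) * q forces G' = F φ a.e. on the
        -- real ball.
        have hlim : ∫⁻ x in b, ‖G' (complexPoint x 0) - F φ (complexPoint x 0)‖ₑ ≤
            liminf (fun j => ∫⁻ x in b, ‖F (u j) (complexPoint x 0) - F φ (complexPoint x 0)‖ₑ)
              atTop := by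
          refine le_trans (le_of_eq ?_) (lintegral_liminf_le fun j =>
            ((hcR (u j)).sub (hcR φ)).measurable.enorm)
          refine setLIntegral_congr_fun Metric.isOpen_ball.measurableSet fun x hx => ?_
          refine Tendsto.liminf_eq ?_ |>.symm
          exact ((hunif.tendsto_at (hreal x hx)).sub tendsto_const_nhds).enorm
        have hle : ∀ j, ∫⁻ x in b, ‖F (u j) (complexPoint x 0) - F φ (complexPoint x 0)‖ₑ ≤
            (∫⁻ t, ‖q t‖ₑ) * (ENNReal.ofReal ‖u j - φ‖ * volume b ^ (1 / 2 : ℝ)) := fun j => by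
          have h1 := lintegral_fconv_le (Lp.memLp (u j - φ)) hq b
          rw [← Lp.enorm_def, ← ofReal_norm] at h1
          refine le_trans (le_of_eq ?_) h1
          refine lintegral_congr_ae (ae_restrict_of_ae ?_)
          rw [fconv_congr_left (Lp.coeFn_sub (u j) φ)]
          filter_upwards [(hF (u j)).2, (hF φ).2,
            fconv_sub_left (Lp.memLp (u j)) (Lp.memLp φ) hq] with x h2 h3 h4
          rw [h4, Pi.sub_apply, h2, h3]
        have htend : Tendsto (fun j => (∫⁻ t, ‖q t‖ₑ) *
            (ENNReal.ofReal ‖u j - φ‖ * volume b ^ (1 / 2 : ℝ))) atTop (𝓝 0) := by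
          have h1 : Tendsto (fun j => ENNReal.ofReal ‖u j - φ‖) atTop (𝓝 0) := by
            rw [← ENNReal.ofReal_zero]
            exact ENNReal.tendsto_ofReal (tendsto_iff_norm_sub_tendsto_zero.1 hu)
          have hb : volume b ^ (1 / 2 : ℝ) ≠ ∞ := ENNReal.rpow_ne_top_of_nonneg (by norm_num)
            measure_ball_lt_top.ne
          have h2 := ENNReal.Tendsto.mul_const h1 (Or.inr hb)
          have h3 := ENNReal.Tendsto.const_mul h2 (Or.inr hq.2.ne)
          simpa using h3
        have hz : ∫⁻ x in b, ‖G' (complexPoint x 0) - F φ (complexPoint x 0)‖ₑ = 0 := by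
          refine le_antisymm (hlim.trans ?_) bot_le
          rw [← htend.liminf_eq]
          exact liminf_le_liminf (.of_forall hle)
        have hcG : ContinuousOn (fun x => G' (complexPoint x 0) - F φ (complexPoint x 0)) b :=
          (hGc.comp continuous_complexPoint_zero_right.continuousOn hreal).sub
            (hcR φ).continuousOn
        rw [lintegral_eq_zero_iff' (hcG.aestronglyMeasurable Metric.isOpen_ball.measurableSet).enorm,
          EventuallyEq, ae_restrict_iff' Metric.isOpen_ball.measurableSet] at hz
        filter_upwards [hz] with x hx hxR
        simpa using hx (by simpa [b] using hxR))
    have heq : Set.EqOn G' (F φ) K :=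
      Set.EqOn.of_subset_closure (fun z hz => sub_eq_zero.1 (hzero z hz)) hGc
        (hF φ).1.continuous.continuousOn hsub (closure_ball 0 hR.ne').ge
    ext z
    rw [← hG' z]
    exact heq z.2
  let T' : Lp ℂ 2 (volume : Measure (EuclideanSpace ℝ (Fin n))) →L[ℂ] C(K, ℂ) := ⟨T, hcont⟩
  refine ⟨‖T'‖, fun φ G hG z hz => ?_⟩
  rw [hG.unique (hF φ)]
  exact ((T' φ).norm_coe_le_norm ⟨z, Metric.ball_subset_closedBall hz⟩).trans (T'.le_opNorm φ)

/-- Riesz representation of the bounded evaluation at z, precomposed with the inverse Plancherel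
isometry. -/
theorem exists_inner_eq_entireExtension {q : EuclideanSpace ℝ (Fin n) → ℂ}
    (hq : Integrable q volume)
    (hT : ∀ f : EuclideanSpace ℝ (Fin n) → ℂ, MemLp f 2 volume →
      ∃ F, IsEntireExtension (fconv f q) F) (z : EuclideanSpace ℂ (Fin n)) :
    ∃ k : Lp ℂ 2 (volume : Measure (EuclideanSpace ℝ (Fin n))),
      ∀ φ : Lp ℂ 2 (volume : Measure (EuclideanSpace ℝ (Fin n))), ∀ F,
        IsEntireExtension (fconv (𝓕⁻ φ : Lp ℂ 2 (volume : Measure (EuclideanSpace ℝ (Fin n)))) q) F →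
          F z = inner ℂ k φ := by
  obtain ⟨C, hC⟩ := exists_norm_entireExtension_le hq hT (‖z‖ + 1)
  choose F hF using fun φ : Lp ℂ 2 (volume : Measure (EuclideanSpace ℝ (Fin n))) =>
    hT φ (Lp.memLp φ)
  have hadd : ∀ φ ψ, F (φ + ψ) = F φ + F ψ := fun φ ψ => by
    refine (hF (φ + ψ)).unique ⟨(hF φ).1.add (hF ψ).1, ?_⟩
    rw [fconv_congr_left (Lp.coeFn_add φ ψ)]
    filter_upwards [(hF φ).2, (hF ψ).2, fconv_add_left (Lp.memLp φ) (Lp.memLp ψ) hq]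
      with x h1 h2 h3
    rw [h3, Pi.add_apply, Pi.add_apply, h1, h2]
  have hsmul : ∀ (c : ℂ) φ, F (c • φ) = c • F φ := fun c φ => by
    refine (hF (c • φ)).unique ⟨(hF φ).1.const_smul c, ?_⟩
    rw [fconv_congr_left (Lp.coeFn_smul c φ), fconv_smul_left]
    filter_upwards [(hF φ).2] with x h1
    rw [Pi.smul_apply, Pi.smul_apply, h1]
  let ev : Lp ℂ 2 (volume : Measure (EuclideanSpace ℝ (Fin n))) →L[ℂ] ℂ :=
    LinearMap.mkContinuous
      { toFun := fun φ => F φ z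
        map_add' := fun φ ψ => by simp [hadd]
        map_smul' := fun c φ => by simp [hsmul] } C fun φ => hC φ (F φ) (hF φ) z (by simp)
  let U := (Lp.fourierTransformₗᵢ (EuclideanSpace ℝ (Fin n)) ℂ).symm
  refine ⟨(InnerProductSpace.toDual ℂ _).symm (ev ∘L U.toContinuousLinearEquiv.toContinuousLinearMap),
    fun φ G hG => ?_⟩
  rw [InnerProductSpace.toDual_symm_apply]
  rw [hG.unique (hF _)]
  rfl

/-- If `f * q` extends to an entire function for each `f ∈ L²`, then `𝓕 q` decays faster than
every exponential, and the extension is given by the Fourier–Laplace integral. -/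
theorem memLp_fourier_mul_planeWave {q : EuclideanSpace ℝ (Fin n) → ℂ}
    (hq : Integrable q volume)
    (hT : ∀ f : EuclideanSpace ℝ (Fin n) → ℂ, MemLp f 2 volume →
      ∃ F, IsEntireExtension (fconv f q) F) (z : EuclideanSpace ℂ (Fin n)) :
    MemLp (fun ξ => 𝓕 q ξ * planeWave ξ z) 2 volume ∧
      ∀ φ : Lp ℂ 2 (volume : Measure (EuclideanSpace ℝ (Fin n))), ∀ F,
        IsEntireExtension (fconv (𝓕⁻ φ : Lp ℂ 2 (volume : Measure (EuclideanSpace ℝ (Fin n)))) q) F →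
          F z = fourierLaplace (fun ξ => φ ξ * 𝓕 q ξ) z := by
  obtain ⟨k, hk⟩ := exists_inner_eq_entireExtension hq hT z
  set m : EuclideanSpace ℝ (Fin n) → ℂ := fun ξ => 𝓕 q ξ * planeWave ξ z with hm
  have hqc : Continuous (𝓕 q) := continuous_fourier_of_integrable hq
  have hmc : Continuous m := hqc.mul (continuous_planeWave_left z)
  have hball : ∀ N : ℕ, ∀ᵐ ξ, ξ ∈ Metric.closedBall (0 : EuclideanSpace ℝ (Fin n)) N →
      k ξ = starRingEnd ℂ (m ξ) := by
    intro N
    set b := Metric.closedBall (0 : EuclideanSpace ℝ (Fin n)) N with hb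
    have hbm : MeasurableSet b := Metric.isClosed_closedBall.measurableSet
    have hbf : volume b ≠ ∞ := measure_closedBall_lt_top.ne
    have hmb : MemLp (b.indicator fun ξ => starRingEnd ℂ (m ξ)) 2 volume :=
      (Complex.continuous_conj.comp hmc).memLp_indicator_closedBall 2 0 N
    -- For this test function the Riesz formula and the explicit Fourier–Laplace integral give the
    -- same value, while their difference is ∫ |φ|². Hence k = conj m a.e. on b.
    let φ : EuclideanSpace ℝ (Fin n) → ℂ := b.indicator fun ξ => k ξ - starRingEnd ℂ (m ξ)
    have hφ : MemLp φ 2 volume := by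
      have := ((Lp.memLp k).indicator hbm).sub hmb
      rwa [← Set.indicator_sub'] at this
    have hφR : ∀ ξ, (N : ℝ) < ‖ξ‖ → φ ξ = 0 := fun ξ hξ =>
      Set.indicator_of_notMem (by simpa [hb] using hξ) _
    have h1 := hk (hφ.toLp φ) _ (isEntireExtension_fconv_fourierInv hφ hφR hq)
    have h2 : inner ℂ k (hφ.toLp φ) = ∫ ξ, φ ξ * starRingEnd ℂ (k ξ) := by
      rw [L2.inner_def]
      refine integral_congr_ae ?_
      filter_upwards [hφ.coeFn_toLp] with ξ hξ
      rw [hξ, RCLike.inner_apply]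
    have h3 : ∫ ξ, (φ ξ * starRingEnd ℂ (k ξ) - φ ξ * m ξ) = 0 := by
      have hi1 : Integrable (fun ξ => φ ξ * starRingEnd ℂ (k ξ)) volume :=
        hφ.integrable_mul (Lp.memLp k).star
      have hi2 : Integrable (fun ξ => φ ξ * m ξ) volume :=
        (hφ.mul_continuous_of_bounded_support hφR hmc).integrable_of_bounded_support
          fun ξ hξ => by rw [hφR ξ hξ, zero_mul]
      rw [integral_sub hi1 hi2, ← h2, ← h1, fourierLaplace]
      simp only [hm, mul_assoc, sub_self]
    have h4 : ∀ ξ, φ ξ * starRingEnd ℂ (k ξ) - φ ξ * m ξ = ((‖φ ξ‖ ^ 2 : ℝ) : ℂ) := by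
      intro ξ
      by_cases hξ : ξ ∈ b
      · have h5 : φ ξ = k ξ - starRingEnd ℂ (m ξ) := Set.indicator_of_mem hξ _
        rw [← mul_sub, Complex.ofReal_pow, ← Complex.mul_conj', h5, map_sub, Complex.conj_conj]
      · have h5 : φ ξ = 0 := Set.indicator_of_notMem hξ _
        simp [h5]
    simp only [h4] at h3
    rw [integral_complex_ofReal, Complex.ofReal_eq_zero,
      integral_eq_zero_iff_of_nonneg (fun ξ => by positivity) hφ.norm.integrable_sq] at h3
    filter_upwards [h3] with ξ hξ hξb
    have h5 : φ ξ = k ξ - starRingEnd ℂ (m ξ) := Set.indicator_of_mem hξb _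
    have h6 : φ ξ = 0 := by simpa using hξ
    exact sub_eq_zero.1 (h5.symm.trans h6)
  have hae : m =ᵐ[volume] fun ξ => starRingEnd ℂ (k ξ) := by
    filter_upwards [ae_all_iff.2 hball] with ξ hξ
    obtain ⟨N, hN⟩ := exists_nat_ge ‖ξ‖
    rw [hξ N (by simpa using hN), Complex.conj_conj]
  refine ⟨(memLp_congr_ae hae).2 (Lp.memLp k).star, fun φ F hF => ?_⟩
  rw [hk φ F hF, L2.inner_def, fourierLaplace]
  refine integral_congr_ae ?_
  filter_upwards [hae] with ξ hξ
  rw [mul_assoc, RCLike.inner_apply, ← hξ]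

end PointEvaluation

/-! ### Multipliers of L² -/

section Multiplier

variable {α : Type*} [MeasurableSpace α] {μ : Measure α}

theorem eLpNorm_two_sq {E : Type*} [NormedAddCommGroup E] (f : α → E) :
    eLpNorm f 2 μ ^ 2 = ∫⁻ x, ‖f x‖ₑ ^ 2 ∂μ := by
  have := eLpNorm_nnreal_pow_eq_lintegral (μ := μ) (f := f) (p := 2) (by norm_num)
  simpa using this

theorem memLp_two_iff_lintegral_lt_top {E : Type*} [NormedAddCommGroup E] {f : α → E}
    (hf : AEStronglyMeasurable f μ) : MemLp f 2 μ ↔ ∫⁻ x, ‖f x‖ₑ ^ 2 ∂μ < ∞ := by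
  rw [← eLpNorm_two_sq]
  simp [MemLp, hf]

/-- A measurable function that multiplies `L²` into itself is essentially bounded. -/
theorem exists_ae_norm_le_of_memLp_mul [SigmaFinite μ] {k : α → ℂ} (hk : Measurable k)
    (h : ∀ φ : α → ℂ, MemLp φ 2 μ → MemLp (fun x => k x * φ x) 2 μ) :
    ∃ C : ℝ, ∀ᵐ x ∂μ, ‖k x‖ ≤ C := by
  by_contra hcon
  push Not at hcon
  have hA : ∀ j : ℕ, ∃ t, MeasurableSet t ∧ t ⊆ {x | (2 : ℝ) ^ j < ‖k x‖} ∧ 0 < μ t ∧ μ t < ∞ := by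
    intro j
    refine Measure.exists_subset_measure_lt_top (measurableSet_lt measurable_const hk.norm) ?_
    rw [pos_iff_ne_zero]
    intro h0
    refine hcon (2 ^ j) ?_
    rw [ae_iff]
    simpa using h0
  choose A hAm hAs hA0 hAf using hA
  -- Normalised so that ∫ g = ∑ 2⁻ʲ = 2, whereas ∫ |k|² g ≥ 4ʲ · 2⁻ʲ = 2ʲ for every j. Thus √g is in
  -- L² but k √g is not.
  let g : α → ℝ≥0∞ := fun x => ∑' j, (A j).indicator (fun _ => 2⁻¹ ^ j / μ (A j)) x
  have hgm : Measurable g := Measurable.tsum fun j => measurable_const.indicator (hAm j)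
  have hgi : ∫⁻ x, g x ∂μ = ∑' j : ℕ, 2⁻¹ ^ j := by
    rw [lintegral_tsum fun j => (measurable_const.indicator (hAm j)).aemeasurable]
    refine tsum_congr fun j => ?_
    rw [lintegral_indicator_const (hAm j), ENNReal.div_mul_cancel (hA0 j).ne' (hAf j).ne]
  have hgfin : ∫⁻ x, g x ∂μ < ∞ := by
    rw [hgi, ENNReal.tsum_geometric, ENNReal.one_sub_inv_two, inv_inv]
    exact ENNReal.ofNat_lt_top
  let φ : α → ℂ := fun x => (Real.sqrt (g x).toReal : ℂ)
  have hφm : Measurable φ := by fun_prop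
  have hφ : ∀ᵐ x ∂μ, ‖φ x‖ₑ ^ 2 = g x := by
    filter_upwards [ae_lt_top hgm hgfin.ne] with x hx
    have h1 : ‖φ x‖ₑ = ENNReal.ofReal (Real.sqrt (g x).toReal) := by
      rw [← ofReal_norm, Complex.norm_real, Real.norm_of_nonneg (Real.sqrt_nonneg _)]
    rw [h1, ← ENNReal.ofReal_pow (Real.sqrt_nonneg _), Real.sq_sqrt ENNReal.toReal_nonneg,
      ENNReal.ofReal_toReal hx.ne]
  have hφL : MemLp φ 2 μ := by
    rw [memLp_two_iff_lintegral_lt_top hφm.aestronglyMeasurable, lintegral_congr_ae hφ]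
    exact hgfin
  have hkφ := h φ hφL
  rw [memLp_two_iff_lintegral_lt_top hkφ.aestronglyMeasurable] at hkφ
  have h2 : ∫⁻ x, ‖k x * φ x‖ₑ ^ 2 ∂μ = ∫⁻ x, ‖k x‖ₑ ^ 2 * g x ∂μ := by
    refine lintegral_congr_ae ?_
    filter_upwards [hφ] with x hx
    rw [enorm_mul, mul_pow, hx]
  have h3 : ∀ j : ℕ, (2 : ℝ≥0∞) ^ j ≤ ∫⁻ x, ‖k x‖ₑ ^ 2 * g x ∂μ := by
    intro j
    calc (2 : ℝ≥0∞) ^ j = (2 ^ j) ^ 2 * (2⁻¹ ^ j / μ (A j)) * μ (A j) := by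
          rw [mul_assoc, ENNReal.div_mul_cancel (hA0 j).ne' (hAf j).ne, sq, mul_assoc, ← mul_pow,
            ENNReal.mul_inv_cancel (by norm_num) (by norm_num), one_pow, mul_one]
      _ = ∫⁻ x in A j, (2 ^ j) ^ 2 * (2⁻¹ ^ j / μ (A j)) ∂μ := by rw [setLIntegral_const]
      _ ≤ ∫⁻ x in A j, ‖k x‖ₑ ^ 2 * g x ∂μ := by
          refine setLIntegral_mono' (hAm j) fun x hx => ?_
          gcongr
          · have h4 : (2 : ℝ) ^ j < ‖k x‖ := hAs j hx
            rw [← ofReal_norm]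
            calc (2 : ℝ≥0∞) ^ j = ENNReal.ofReal (2 ^ j) := by
                  rw [ENNReal.ofReal_pow (by norm_num)]; norm_num
              _ ≤ _ := ENNReal.ofReal_le_ofReal h4.le
          · refine le_trans (le_of_eq ?_) (ENNReal.le_tsum j)
            rw [Set.indicator_of_mem hx]
      _ ≤ _ := setLIntegral_le_lintegral _ _
  rw [h2] at hkφ
  have htop : ∫⁻ x, ‖k x‖ₑ ^ 2 * g x ∂μ = ∞ := by
    exact top_unique (le_of_tendsto' (ENNReal.tendsto_pow_atTop_nhds_top_iff.2 ENNReal.one_lt_two) h3)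
  exact hkφ.ne htop

/-- The quotient u / v multiplies L² into itself, because |(u / v) φ| ≤ |ψ| a.e.; division by zero
gives 0 there. That u vanishes a.e. where v does is tested separately, on indicators of sets of
finite measure exhausting the space. -/
theorem exists_ae_norm_le_mul_norm [SigmaFinite μ] {u v : α → ℂ} (hu : Measurable u)
    (hv : Measurable v)
    (h : ∀ φ : α → ℂ, MemLp φ 2 μ → ∃ ψ : α → ℂ, MemLp ψ 2 μ ∧
      (fun x => u x * φ x) =ᵐ[μ] fun x => ψ x * v x) :
    ∃ C : ℝ, ∀ᵐ x ∂μ, ‖u x‖ ≤ C * ‖v x‖ := by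
  obtain ⟨C, hC⟩ := exists_ae_norm_le_of_memLp_mul (μ := μ) (hu.div hv) fun φ hφ => by
    obtain ⟨ψ, hψ, heq⟩ := h φ hφ
    refine hψ.of_le ((hu.div hv).aestronglyMeasurable.mul hφ.aestronglyMeasurable) ?_
    filter_upwards [heq] with x hx
    simp only [Pi.div_apply]
    by_cases hv0 : v x = 0
    · simp [hv0]
    · rw [div_mul_eq_mul_div, hx, mul_div_cancel_right₀ _ hv0]
  have hzero : ∀ N : ℕ, ∀ᵐ x ∂μ, x ∈ spanningSets μ N → v x = 0 → u x = 0 := by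
    intro N
    obtain ⟨ψ, -, heq⟩ := h ((spanningSets μ N).indicator fun _ => 1)
      (memLp_indicator_const 2 (measurableSet_spanningSets μ N) 1
        (Or.inr (measure_spanningSets_lt_top μ N).ne))
    filter_upwards [heq] with x hx hxN hv0
    simpa [hv0, hxN] using hx
  refine ⟨C, ?_⟩
  filter_upwards [hC, ae_all_iff.2 hzero] with x hx hx0
  by_cases hv0 : v x = 0
  · rw [hx0 (spanningSetsIndex μ x) (mem_spanningSetsIndex μ x) hv0]
    simp [hv0]
  · rwa [Pi.div_apply, norm_div, div_le_iff₀ (norm_pos_iff.2 hv0)] at hx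

end Multiplier

/-! ### The Bergman norm on the Fourier side -/

section BergmanNorm

open FourierTransform RealInnerProductSpace

variable {n : ℕ}

theorem lintegral_fourierInv_sq {φ : EuclideanSpace ℝ (Fin n) → ℂ} (h1 : Integrable φ volume)
    (h2 : MemLp φ 2 volume) : ∫⁻ x, ‖𝓕⁻ φ x‖ₑ ^ 2 = ∫⁻ ξ, ‖φ ξ‖ₑ ^ 2 := by
  have h3 : ‖(𝓕⁻ (h2.toLp φ) : Lp ℂ 2 (volume : Measure (EuclideanSpace ℝ (Fin n))))‖ =
      ‖h2.toLp φ‖ := (Lp.fourierTransformₗᵢ (EuclideanSpace ℝ (Fin n)) ℂ).symm.norm_map _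
  have h4 := congrArg ENNReal.ofReal h3
  rw [ofReal_norm, ofReal_norm, Lp.enorm_def, Lp.enorm_def,
    eLpNorm_congr_ae (fourierInv_toLp_ae_eq h1 h2), eLpNorm_congr_ae h2.coeFn_toLp] at h4
  rw [← eLpNorm_two_sq, ← eLpNorm_two_sq, h4]

/-- The weight on the Fourier side that describes the norm of the weighted Bergman space:
`ξ ↦ ∫ w(y) exp (-4π y·ξ) dy`. -/
noncomputable def laplaceWeight (w : EuclideanSpace ℝ (Fin n) → ℝ≥0)
    (ξ : EuclideanSpace ℝ (Fin n)) : ℝ≥0∞ :=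
  ∫⁻ y, ‖planeWave ξ (complexPoint 0 y)‖ₑ ^ 2 * w y

theorem enorm_planeWave (ξ x y : EuclideanSpace ℝ (Fin n)) :
    ‖planeWave ξ (complexPoint x y)‖ₑ = ENNReal.ofReal (Real.exp (-(2 * Real.pi * ⟪ξ, y⟫))) := by
  rw [← ofReal_norm, norm_planeWave]

theorem measurable_laplaceWeight_integrand {w : EuclideanSpace ℝ (Fin n) → ℝ≥0}
    (hw : Measurable w) :
    Measurable fun p : EuclideanSpace ℝ (Fin n) × EuclideanSpace ℝ (Fin n) =>
      ‖planeWave p.1 (complexPoint 0 p.2)‖ₑ ^ 2 * (w p.2 : ℝ≥0∞) := by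
  simp only [enorm_planeWave]
  fun_prop

theorem measurable_laplaceWeight {w : EuclideanSpace ℝ (Fin n) → ℝ≥0} (hw : Measurable w) :
    Measurable (laplaceWeight w) :=
  (measurable_laplaceWeight_integrand hw).lintegral_prod_right'

/-- Plancherel in x for each fixed y, where iy only multiplies h by a real exponential; then
Tonelli. -/
theorem lintegral_fourierLaplace_sq {w : EuclideanSpace ℝ (Fin n) → ℝ≥0} (hw : Measurable w)
    {h : EuclideanSpace ℝ (Fin n) → ℂ} (hh : MemLp h 2 volume) {R : ℝ}
    (hR : ∀ ξ, R < ‖ξ‖ → h ξ = 0) :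
    ∫⁻ p : EuclideanSpace ℝ (Fin n) × EuclideanSpace ℝ (Fin n),
      ‖fourierLaplace h (complexPoint p.1 p.2)‖ₑ ^ 2 * (w p.2 : ℝ≥0∞) =
      ∫⁻ ξ, ‖h ξ‖ₑ ^ 2 * laplaceWeight w ξ := by
  have hc : Continuous (fourierLaplace h) :=
    (differentiable_fourierLaplace (hh.integrable_of_bounded_support hR) hR).continuous
  have hm : Measurable fun p : EuclideanSpace ℝ (Fin n) × EuclideanSpace ℝ (Fin n) =>
      ‖fourierLaplace h (complexPoint p.1 p.2)‖ₑ ^ 2 * (w p.2 : ℝ≥0∞) :=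
    ((hc.comp continuous_complexPoint).measurable.enorm.pow_const 2).mul
      (hw.comp measurable_snd).coe_nnreal_ennreal
  rw [Measure.volume_eq_prod, lintegral_prod_symm' _ hm]
  have hin : ∀ y, ∫⁻ x, ‖fourierLaplace h (complexPoint x y)‖ₑ ^ 2 * (w y : ℝ≥0∞) =
      ∫⁻ ξ, ‖h ξ‖ₑ ^ 2 * (‖planeWave ξ (complexPoint 0 y)‖ₑ ^ 2 * w y) := by
    intro y
    have h2 := hh.mul_continuous_of_bounded_support hR
      (continuous_planeWave_left (complexPoint 0 y))
    have h1 := h2.integrable_of_bounded_support fun ξ hξ => by rw [hR ξ hξ, zero_mul]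
    rw [lintegral_mul_const' _ _ ENNReal.coe_ne_top]
    simp only [fourierLaplace_complexPoint]
    rw [lintegral_fourierInv_sq h1 h2, ← lintegral_mul_const' _ _ ENNReal.coe_ne_top]
    simp only [enorm_mul, mul_pow, mul_assoc]
  simp only [hin]
  rw [lintegral_lintegral_swap]
  · refine lintegral_congr fun ξ => ?_
    rw [laplaceWeight, lintegral_const_mul' _ _ (by finiteness)]
  · have h3 : AEMeasurable (fun p : EuclideanSpace ℝ (Fin n) × EuclideanSpace ℝ (Fin n) =>
        ‖h p.2‖ₑ ^ 2) (volume.prod volume) :=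
      (hh.aestronglyMeasurable.comp_snd.enorm.pow_const 2)
    exact h3.mul ((measurable_laplaceWeight_integrand hw).comp measurable_swap).aemeasurable

theorem laplaceWeight_convex (w : EuclideanSpace ℝ (Fin n) → ℝ≥0) (hw : Measurable w)
    (ξ η : EuclideanSpace ℝ (Fin n)) {a b : ℝ} (ha : 0 ≤ a) (hb : 0 ≤ b) (hab : a + b = 1) :
    laplaceWeight w (a • ξ + b • η) ≤
      ENNReal.ofReal a * laplaceWeight w ξ + ENNReal.ofReal b * laplaceWeight w η := by
  have hm : ∀ ξ, Measurable fun y => ‖planeWave ξ (complexPoint 0 y)‖ₑ ^ 2 * (w y : ℝ≥0∞) := by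
    simp only [enorm_planeWave]
    fun_prop
  simp only [laplaceWeight]
  rw [← lintegral_const_mul _ (hm ξ), ← lintegral_const_mul _ (hm η),
    ← lintegral_add_left ((hm ξ).const_mul _)]
  refine lintegral_mono fun y => ?_
  rw [← mul_assoc, ← mul_assoc, ← add_mul]
  gcongr
  simp only [enorm_planeWave, ← ENNReal.ofReal_pow (Real.exp_nonneg _), ← Real.exp_nat_mul]
  rw [← ENNReal.ofReal_mul ha, ← ENNReal.ofReal_mul hb, ← ENNReal.ofReal_add (by positivity)
    (by positivity)]
  refine ENNReal.ofReal_le_ofReal ?_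
  have := convexOn_exp.2 (Set.mem_univ ((2 : ℕ) * -(2 * Real.pi * ⟪ξ, y⟫)))
    (Set.mem_univ ((2 : ℕ) * -(2 * Real.pi * ⟪η, y⟫))) ha hb hab
  simp only [smul_eq_mul] at this
  refine le_trans (le_of_eq ?_) this
  congr 1
  simp only [inner_add_left, inner_smul_left, RCLike.conj_to_real]
  ring

theorem convex_laplaceWeight_lt_top {w : EuclideanSpace ℝ (Fin n) → ℝ≥0} (hw : Measurable w) :
    Convex ℝ {ξ | laplaceWeight w ξ < ∞} := by
  intro ξ hξ η hη a b ha hb hab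
  exact (laplaceWeight_convex w hw ξ η ha hb hab).trans_lt
    (ENNReal.add_lt_top.2 ⟨ENNReal.mul_lt_top ENNReal.ofReal_lt_top hξ,
      ENNReal.mul_lt_top ENNReal.ofReal_lt_top hη⟩)

/-- A finite convex function is continuous on the interior of its domain, hence bounded on small
closed balls there. -/
theorem exists_laplaceWeight_le {w : EuclideanSpace ℝ (Fin n) → ℝ≥0} (hw : Measurable w)
    {ξ₀ : EuclideanSpace ℝ (Fin n)} (hξ₀ : ξ₀ ∈ interior {ξ | laplaceWeight w ξ < ∞}) :
    ∃ r > 0, ∃ M : ℝ≥0∞, M < ∞ ∧ ∀ ξ ∈ Metric.closedBall ξ₀ r, laplaceWeight w ξ ≤ M := by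
  have hconv : ConvexOn ℝ {ξ | laplaceWeight w ξ < ∞} fun ξ => (laplaceWeight w ξ).toReal := by
    refine ⟨convex_laplaceWeight_lt_top hw, fun ξ hξ η hη a b ha hb hab => ?_⟩
    have h1 : ENNReal.ofReal a * laplaceWeight w ξ < ∞ := ENNReal.mul_lt_top ENNReal.ofReal_lt_top hξ
    have h2 : ENNReal.ofReal b * laplaceWeight w η < ∞ := ENNReal.mul_lt_top ENNReal.ofReal_lt_top hη
    have := ENNReal.toReal_mono (ENNReal.add_lt_top.2 ⟨h1, h2⟩).ne
      (laplaceWeight_convex w hw ξ η ha hb hab)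
    rwa [ENNReal.toReal_add h1.ne h2.ne, ENNReal.toReal_mul, ENNReal.toReal_mul,
      ENNReal.toReal_ofReal ha, ENNReal.toReal_ofReal hb] at this
  obtain ⟨r, hr, hball⟩ := Metric.nhds_basis_closedBall.mem_iff.1 (isOpen_interior.mem_nhds hξ₀)
  obtain ⟨M, hM⟩ := (isCompact_closedBall ξ₀ r).exists_bound_of_continuousOn
    (hconv.continuousOn_interior.mono hball)
  refine ⟨r, hr, ENNReal.ofReal M, ENNReal.ofReal_lt_top, fun ξ hξ => ?_⟩
  have h1 : ξ ∈ {ξ | laplaceWeight w ξ < ∞} := interior_subset (hball hξ)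
  rw [Set.mem_ofPred_eq] at h1
  rw [← ENNReal.ofReal_toReal h1.ne]
  exact ENNReal.ofReal_le_ofReal ((le_abs_self _).trans (hM ξ hξ))

end BergmanNorm

/-! ### Consequences of the image being the whole Bergman space -/

section ImageOfTransform

open FourierTransform RealInnerProductSpace

variable {n : ℕ} {q : EuclideanSpace ℝ (Fin n) → ℂ} {w : EuclideanSpace ℝ (Fin n) → ℝ≥0}

theorem ImageIsBergman.exists_extension (himage : ImageIsBergman q w)
    (f : EuclideanSpace ℝ (Fin n) → ℂ) (hf : MemLp f 2 volume) :
    ∃ F, IsEntireExtension (fconv f q) F :=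
  let ⟨F, _, hF⟩ := himage.1 f hf
  ⟨F, hF⟩

theorem ImageIsBergman.memLp_fourier (himage : ImageIsBergman q w) (hq : Integrable q volume) :
    MemLp (𝓕 q) 2 volume := by
  have := (memLp_fourier_mul_planeWave hq himage.exists_extension 0).1
  simpa [planeWave] using this

theorem ImageIsBergman.integrable_mul_fourier (himage : ImageIsBergman q w)
    (hq : Integrable q volume) {φ : EuclideanSpace ℝ (Fin n) → ℂ} (hφ : MemLp φ 2 volume) :
    Integrable (fun ξ => φ ξ * 𝓕 q ξ) volume :=
  hφ.integrable_mul (himage.memLp_fourier hq)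

theorem ImageIsBergman.exists_fourierLaplace_eq (himage : ImageIsBergman q w)
    (hq : Integrable q volume) {F : EuclideanSpace ℂ (Fin n) → ℂ} (hF : F ∈ weightedBergman w) :
    ∃ φ : EuclideanSpace ℝ (Fin n) → ℂ, MemLp φ 2 volume ∧
      F = fourierLaplace fun ξ => φ ξ * 𝓕 q ξ := by
  obtain ⟨f, hf, hfF⟩ := himage.2 F hF
  refine ⟨(𝓕 (hf.toLp f) : Lp ℂ 2 (volume : Measure (EuclideanSpace ℝ (Fin n)))), Lp.memLp _, ?_⟩
  funext z
  refine (memLp_fourier_mul_planeWave hq himage.exists_extension z).2 _ F ?_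
  rw [Lp.instFourierPair.fourierInv_fourier_eq, fconv_congr_left hf.coeFn_toLp]
  exact hfF

theorem ImageIsBergman.fourierLaplace_mem_and_isEntireExtension (himage : ImageIsBergman q w)
    (hq : Integrable q volume) {φ : EuclideanSpace ℝ (Fin n) → ℂ} (hφ : MemLp φ 2 volume) :
    (fourierLaplace fun ξ => φ ξ * 𝓕 q ξ) ∈ weightedBergman w ∧ IsEntireExtension
      (fconv (𝓕⁻ (hφ.toLp φ) : Lp ℂ 2 (volume : Measure (EuclideanSpace ℝ (Fin n)))) q)
      (fourierLaplace fun ξ => φ ξ * 𝓕 q ξ) := by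
  obtain ⟨F, hFB, hF⟩ := himage.1 _
    (Lp.memLp (𝓕⁻ (hφ.toLp φ) : Lp ℂ 2 (volume : Measure (EuclideanSpace ℝ (Fin n)))))
  have h1 : F = fourierLaplace (fun ξ => φ ξ * 𝓕 q ξ) := by
    funext z
    rw [(memLp_fourier_mul_planeWave hq himage.exists_extension z).2 _ F hF]
    refine integral_congr_ae ?_
    filter_upwards [hφ.coeFn_toLp] with ξ hξ
    rw [hξ]
  exact h1 ▸ ⟨hFB, hF⟩

/-- Elements of `L²(W)` with bounded support are multiples of `𝓕 q` with an `L²` factor. -/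
theorem ImageIsBergman.exists_ae_eq_mul (himage : ImageIsBergman q w) (hq : Integrable q volume)
    (hw : Measurable w) {h : EuclideanSpace ℝ (Fin n) → ℂ} (hh : MemLp h 2 volume) {R : ℝ}
    (hR : ∀ ξ, R < ‖ξ‖ → h ξ = 0) (hfin : ∫⁻ ξ, ‖h ξ‖ₑ ^ 2 * laplaceWeight w ξ < ∞) :
    ∃ φ : EuclideanSpace ℝ (Fin n) → ℂ, MemLp φ 2 volume ∧
      h =ᵐ[volume] fun ξ => φ ξ * 𝓕 q ξ := by
  have hi := hh.integrable_of_bounded_support hR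
  obtain ⟨φ, hφ, heq⟩ := himage.exists_fourierLaplace_eq hq (F := fourierLaplace h)
    ⟨differentiable_fourierLaplace hi hR, by rwa [lintegral_fourierLaplace_sq hw hh hR]⟩
  refine ⟨φ, hφ, ae_eq_of_fourierInv_eq hi (himage.integrable_mul_fourier hq hφ) ?_⟩
  funext x
  rw [← fourierLaplace_real, ← fourierLaplace_real, heq]

/-- Near ξ₀ the weight is bounded, so by surjectivity every L² function on a small ball is an L²
multiple of `𝓕 q`. The multiplier bound then gives 1 ≤ C |`𝓕 q`| a.e. on the ball, which continuity
makes incompatible with a zero at ξ₀. -/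
theorem ImageIsBergman.fourier_ne_zero_of_mem_interior (himage : ImageIsBergman q w)
    (hq : Integrable q volume) (hw : Measurable w) {ξ₀ : EuclideanSpace ℝ (Fin n)}
    (hξ₀ : ξ₀ ∈ interior {ξ | laplaceWeight w ξ < ∞}) : 𝓕 q ξ₀ ≠ 0 := by
  obtain ⟨r, hr, M, hM, hb⟩ := exists_laplaceWeight_le hw hξ₀
  have hqc := continuous_fourier_of_integrable hq
  set b := Metric.closedBall ξ₀ r
  have hbm : MeasurableSet b := Metric.isClosed_closedBall.measurableSet
  obtain ⟨C, hC⟩ := exists_ae_norm_le_mul_norm (μ := volume)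
    (u := b.indicator fun _ => (1 : ℂ)) (measurable_const.indicator hbm) hqc.measurable
    fun φ hφ => by
      have h1 : (fun x => b.indicator (fun _ => (1 : ℂ)) x * φ x) = b.indicator φ := by
        funext x
        by_cases hx : x ∈ b <;> simp [hx]
      rw [h1]
      refine himage.exists_ae_eq_mul hq hw (R := ‖ξ₀‖ + r) (hφ.indicator hbm)
        (fun ξ hξ => Set.indicator_of_notMem (fun hξb => ?_) _) ?_
      · have h2 := norm_sub_norm_le ξ ξ₀
        have h3 : ‖ξ - ξ₀‖ ≤ r := by simpa [b, dist_eq_norm] using hξb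
        linarith
      · have h2 := (memLp_two_iff_lintegral_lt_top hφ.aestronglyMeasurable).1 hφ
        calc _ ≤ ∫⁻ ξ, ‖φ ξ‖ₑ ^ 2 * M := by
              refine lintegral_mono fun ξ => ?_
              by_cases hξ : ξ ∈ b
              · simp only [Set.indicator_of_mem hξ]
                gcongr
                exact hb ξ hξ
              · simp [Set.indicator_of_notMem hξ]
          _ = (∫⁻ ξ, ‖φ ξ‖ₑ ^ 2) * M := lintegral_mul_const' _ _ hM.ne
          _ < ∞ := ENNReal.mul_lt_top h2 hM
  intro h0
  have hopen : IsOpen ({ξ | C * ‖𝓕 q ξ‖ < 1} ∩ Metric.ball ξ₀ r) :=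
    (isOpen_lt (continuous_const.mul hqc.norm) continuous_const).inter Metric.isOpen_ball
  have hnull : volume ({ξ | C * ‖𝓕 q ξ‖ < 1} ∩ Metric.ball ξ₀ r) = 0 := by
    refine measure_mono_null ?_ (ae_iff.1 hC)
    rintro ξ ⟨h1, h2⟩
    have h3 : ξ ∈ b := Metric.ball_subset_closedBall h2
    simpa [h3] using h1
  rw [hopen.measure_eq_zero_iff volume] at hnull
  have hmem : ξ₀ ∈ {ξ | C * ‖𝓕 q ξ‖ < 1} ∩ Metric.ball ξ₀ r :=
    ⟨by simp [h0], Metric.mem_ball_self hr⟩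
  simp [hnull] at hmem

/-- On a ball where `𝓕 q` has no zero, membership of the image in the Bergman space makes the weight
finite a.e. Some pair ξ₀ ± u then has finite weight, and convexity gives finiteness at the midpoint
ξ₀. -/
theorem ImageIsBergman.laplaceWeight_lt_top (himage : ImageIsBergman q w)
    (hq : Integrable q volume) (hw : Measurable w) {ξ₀ : EuclideanSpace ℝ (Fin n)}
    (hξ₀ : 𝓕 q ξ₀ ≠ 0) : laplaceWeight w ξ₀ < ∞ := by
  have hqc := continuous_fourier_of_integrable hq
  obtain ⟨r, hr, hball⟩ := Metric.nhds_basis_closedBall.mem_iff.1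
    ((isOpen_ne_fun hqc continuous_const).mem_nhds hξ₀)
  set b := Metric.closedBall ξ₀ r
  have hbm : MeasurableSet b := Metric.isClosed_closedBall.measurableSet
  have hφ : MemLp (b.indicator fun _ => (1 : ℂ)) 2 volume :=
    memLp_indicator_const 2 hbm 1 (Or.inr measure_closedBall_lt_top.ne)
  have hφR : ∀ ξ, ‖ξ₀‖ + r < ‖ξ‖ → b.indicator (fun _ => (1 : ℂ)) ξ = 0 := fun ξ hξ =>
    Set.indicator_of_notMem (fun hξb => by
      have h2 := norm_sub_norm_le ξ ξ₀
      have h3 : ‖ξ - ξ₀‖ ≤ r := by simpa [b, dist_eq_norm] using hξb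
      linarith) _
  have h1 := (himage.fourierLaplace_mem_and_isEntireExtension hq hφ).1.2
  rw [lintegral_fourierLaplace_sq hw (hφ.mul_continuous_of_bounded_support hφR hqc)
    (R := ‖ξ₀‖ + r) fun ξ hξ => by rw [hφR ξ hξ, zero_mul]] at h1
  have hae : ∀ᵐ ξ, ξ ∈ b → laplaceWeight w ξ < ∞ := by
    filter_upwards [ae_lt_top' (((hφ.aestronglyMeasurable.mul
      hqc.aestronglyMeasurable).enorm.pow_const 2).mul
        (measurable_laplaceWeight hw).aemeasurable) h1.ne] with ξ hξ hξb
    by_contra htop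
    simp only [Pi.mul_apply, Set.indicator_of_mem hξb, one_mul, not_lt_top_iff.1 htop] at hξ
    rw [ENNReal.mul_top] at hξ
    · exact lt_irrefl _ hξ
    · have : 𝓕 q ξ ≠ 0 := hball hξb
      simpa using this
  have hadd := (measurePreserving_add_left volume ξ₀).quasiMeasurePreserving.ae hae
  have hsub := ((measurePreserving_add_left volume ξ₀).comp
    (Measure.measurePreserving_neg volume)).quasiMeasurePreserving.ae hae
  have hex : ∃ u ∈ Metric.ball (0 : EuclideanSpace ℝ (Fin n)) r,
      laplaceWeight w (ξ₀ + u) < ∞ ∧ laplaceWeight w (ξ₀ + -u) < ∞ := by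
    by_contra hcon
    push Not at hcon
    have h0 : volume (Metric.ball (0 : EuclideanSpace ℝ (Fin n)) r) = 0 := by
      refine measure_mono_null ?_ (ae_iff.1 (hadd.and hsub))
      intro u hu hcontra
      have hu' : ‖u‖ < r := by simpa using hu
      have h2 := hcontra.1 (by simpa [b] using hu'.le)
      have h3 := hcontra.2 (by simpa [b] using hu'.le)
      exact absurd h3 (by simpa using hcon u hu h2)
    exact (Metric.measure_ball_pos volume _ hr).ne' h0
  obtain ⟨u, -, hu1, hu2⟩ := hex
  have := convex_laplaceWeight_lt_top hw hu1 hu2 (a := 1 / 2) (b := 1 / 2) (by norm_num)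
    (by norm_num) (by norm_num)
  rwa [← smul_add, show ξ₀ + u + (ξ₀ + -u) = (2 : ℝ) • ξ₀ by rw [two_smul]; abel, smul_smul,
    show (1 / 2 * 2 : ℝ) = 1 by norm_num, one_smul] at this

theorem ImageIsBergman.isPreconnected_fourier_ne_zero (himage : ImageIsBergman q w)
    (hq : Integrable q volume) (hw : Measurable w) : IsPreconnected {ξ | 𝓕 q ξ ≠ 0} := by
  have h : {ξ | 𝓕 q ξ ≠ 0} = interior {ξ | laplaceWeight w ξ < ∞} := by
    refine Set.Subset.antisymm ?_ fun ξ hξ => himage.fourier_ne_zero_of_mem_interior hq hw hξ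
    exact interior_maximal (fun ξ hξ => himage.laplaceWeight_lt_top hq hw hξ)
      (isOpen_ne_fun (continuous_fourier_of_integrable hq) continuous_const)
  rw [h]
  exact (convex_laplaceWeight_lt_top hw).interior.isPreconnected

theorem neg_mem_weightedBergman (hw : Measurable w) (heven : ∀ y, w (-y) = w y)
    {F : EuclideanSpace ℂ (Fin n) → ℂ} (hF : F ∈ weightedBergman w) :
    (fun z => F (-z)) ∈ weightedBergman w := by
  refine ⟨hF.1.comp differentiable_id.neg, ?_⟩
  have hm : Measurable fun p : EuclideanSpace ℝ (Fin n) × EuclideanSpace ℝ (Fin n) =>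
      ‖F (complexPoint p.1 p.2)‖ₑ ^ 2 * (w p.2 : ℝ≥0∞) :=
    ((hF.1.continuous.comp continuous_complexPoint).measurable.enorm.pow_const 2).mul
      (hw.comp measurable_snd).coe_nnreal_ennreal
  have h1 := ((Measure.measurePreserving_neg (volume : Measure (EuclideanSpace ℝ (Fin n)))).prod
    (Measure.measurePreserving_neg (volume : Measure (EuclideanSpace ℝ (Fin n))))).lintegral_comp hm
  refine lt_of_eq_of_lt (lintegral_congr fun p => ?_) (h1.trans_lt hF.2)
  simp only [neg_complexPoint, Prod.map_fst, Prod.map_snd, heven]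

theorem fourierLaplace_neg (h : EuclideanSpace ℝ (Fin n) → ℂ) (z : EuclideanSpace ℂ (Fin n)) :
    fourierLaplace h (-z) = fourierLaplace (fun ξ => h (-ξ)) z := by
  rw [fourierLaplace, fourierLaplace, ← integral_neg_eq_self]
  refine integral_congr_ae (.of_forall fun ξ => ?_)
  have : complexDot (-ξ) (-z) = complexDot ξ z := by
    have h1 : complexPoint (-ξ) 0 = -complexPoint ξ 0 := by rw [neg_complexPoint, neg_zero]
    simp [complexDot, h1]
  simp [planeWave, this]

/-- The map z ↦ -z preserves the Bergman space of an even weight. Hence `𝓕 q (-ξ) * φ ξ` with φ ∈ L²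
is always an L² multiple of `𝓕 q`, and the multiplier bound applies. -/
theorem ImageIsBergman.exists_fourier_neg_le (himage : ImageIsBergman q w)
    (hq : Integrable q volume) (hw : Measurable w) (heven : ∀ y, w (-y) = w y) :
    ∃ C : ℝ, ∀ᵐ ξ, ‖𝓕 q (-ξ)‖ ≤ C * ‖𝓕 q ξ‖ := by
  have hqc := continuous_fourier_of_integrable hq
  refine exists_ae_norm_le_mul_norm (u := fun ξ => 𝓕 q (-ξ)) (hqc.comp continuous_neg).measurable
    hqc.measurable fun φ hφ => ?_
  have hφ' : MemLp (fun ξ => φ (-ξ)) 2 volume :=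
    hφ.comp_measurePreserving (Measure.measurePreserving_neg volume)
  obtain ⟨ψ, hψ, heq⟩ := himage.exists_fourierLaplace_eq hq
    (neg_mem_weightedBergman hw heven (himage.fourierLaplace_mem_and_isEntireExtension hq hφ').1)
  refine ⟨ψ, hψ, ?_⟩
  have h1 : Integrable (fun ξ => 𝓕 q (-ξ) * φ ξ) volume := by
    have := (himage.integrable_mul_fourier hq hφ').comp_neg
    simpa [mul_comm] using this
  refine ae_eq_of_fourierInv_eq h1 (himage.integrable_mul_fourier hq hψ) ?_
  funext x
  rw [← fourierLaplace_real, ← fourierLaplace_real, ← heq]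
  simp only [fourierLaplace_neg, neg_neg, mul_comm]

end ImageOfTransform

/-! ### Holomorphic dependence of integrals on a parameter -/

section HolomorphicParameter

open Filter Topology

/-- Dominating the integrand suffices: Cauchy's estimate on discs of radius r/2 dominates the
derivative by g / (r/2). -/
theorem differentiableOn_integral_of_dominated {α : Type*} [MeasurableSpace α] {μ : Measure α}
    {U : Set ℂ} (hU : IsOpen U) {f : ℂ → α → ℂ} {g : α → ℝ}
    (hmeas : ∀ ζ ∈ U, AEStronglyMeasurable (f ζ) μ)
    (hdiff : ∀ x, DifferentiableOn ℂ (fun ζ => f ζ x) U)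
    (hbound : ∀ ζ ∈ U, ∀ x, ‖f ζ x‖ ≤ g x) (hg : Integrable g μ) :
    DifferentiableOn ℂ (fun ζ => ∫ x, f ζ x ∂μ) U := by
  intro ζ₀ hζ₀
  obtain ⟨r, hr, hball⟩ := Metric.nhds_basis_closedBall.mem_iff.1 (hU.mem_nhds hζ₀)
  have hsub : ∀ ζ ∈ Metric.ball ζ₀ (r / 2), Metric.closedBall ζ (r / 2) ⊆ U := fun ζ hζ =>
    (Metric.closedBall_subset_closedBall' (by
      have := Metric.mem_ball.1 hζ
      linarith)).trans hball
  have hmem : ∀ ζ ∈ Metric.ball ζ₀ (r / 2), ζ ∈ U := fun ζ hζ =>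
    hsub ζ hζ (Metric.mem_closedBall_self (by positivity))
  have hderiv : ∀ ζ ∈ U, ∀ x, HasDerivAt (fun ζ => f ζ x) (deriv (fun ζ => f ζ x) ζ) ζ :=
    fun ζ hζ x => ((hdiff x).differentiableAt (hU.mem_nhds hζ)).hasDerivAt
  refine (hasDerivAt_integral_of_dominated_loc_of_deriv_le (𝕜 := ℂ) (F := f)
    (F' := fun ζ x => deriv (fun ζ => f ζ x) ζ) (bound := fun x => g x / (r / 2))
    (Metric.ball_mem_nhds ζ₀ (half_pos hr)) ?_ ?_ ?_ ?_ ?_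
    ?_).2.differentiableAt.differentiableWithinAt
  · filter_upwards [hU.mem_nhds hζ₀] with ζ hζ using hmeas ζ hζ
  · exact hg.mono' (hmeas ζ₀ hζ₀) (.of_forall (hbound ζ₀ hζ₀))
  -- The derivative is measurable in x as a limit of difference quotients along steps that stay in
  -- U.
  · let t : ℕ → ℂ := fun j => ((r / (j + 1) : ℝ) : ℂ)
    have ht0 : Tendsto t atTop (𝓝[≠] 0) := by
      refine tendsto_nhdsWithin_iff.2 ⟨?_, .of_forall fun j => ?_⟩
      · have h1 : Tendsto (fun j : ℕ => r / ((j : ℝ) + 1)) atTop (𝓝 0) :=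
          tendsto_const_nhds.div_atTop
            (tendsto_atTop_add_const_right _ _ tendsto_natCast_atTop_atTop)
        have h2 := (Complex.continuous_ofReal.tendsto 0).comp h1
        rwa [Complex.ofReal_zero] at h2
      · have : r / ((j : ℝ) + 1) ≠ 0 := by positivity
        simpa only [t, Set.mem_compl_iff, Set.mem_singleton_iff, Complex.ofReal_eq_zero] using this
    have htU : ∀ j, ζ₀ + t j ∈ U := fun j => hball (by
      rw [Metric.mem_closedBall, dist_eq_norm, add_sub_cancel_left, Complex.norm_real,
        Real.norm_of_nonneg (by positivity)]
      exact div_le_self hr.le (by simp))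
    refine aestronglyMeasurable_of_tendsto_ae atTop
      (f := fun j x => (t j)⁻¹ • (f (ζ₀ + t j) x - f ζ₀ x)) (fun j => ?_) (.of_forall fun x => ?_)
    · exact ((hmeas _ (htU j)).sub (hmeas _ hζ₀)).const_smul (t j)⁻¹
    · exact (hderiv ζ₀ hζ₀ x).tendsto_slope_zero.comp ht0
  · refine .of_forall fun x ζ hζ => ?_
    exact Complex.norm_deriv_le_of_forall_mem_sphere_norm_le (half_pos hr)
      ((hdiff x).diffContOnCl_ball (hsub ζ hζ))
      fun η hη => hbound η (hsub ζ hζ (Metric.sphere_subset_closedBall hη)) x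
  · exact hg.div_const _
  · exact .of_forall fun x ζ hζ => hderiv ζ (hmem ζ hζ) x

end HolomorphicParameter

/-! ### Reflection and Liouville in a strip -/

section StripReflection

open Filter Topology Complex

/-- The sign s = ±1 selects the right or left half of the strip minus the closed discs with
diameters [0, i] and [0, -i]. Moving horizontally away from the imaginary axis avoids the discs and
ends in the convex part s · Re ζ ≥ 2. -/
theorem isPreconnected_half_strip_diff_discs {s : ℝ} (hs : s * s = 1) :
    IsPreconnected {ζ : ℂ | 0 < s * ζ.re ∧ |ζ.im| < 1 ∧ |ζ.im| < normSq ζ} := by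
  have hT : Convex ℝ {ζ : ℂ | 2 ≤ s * ζ.re ∧ |ζ.im| < 1} := by
    intro ζ hζ η hη a b ha hb hab
    obtain ⟨h1, h2⟩ := hζ
    obtain ⟨h3, h4⟩ := hη
    rw [abs_lt] at h2 h4
    refine ⟨?_, abs_lt.2 ⟨?_, ?_⟩⟩
    · simp only [add_re, real_smul, mul_re, ofReal_re, ofReal_im, zero_mul, sub_zero]
      nlinarith
    · simp only [add_im, real_smul, mul_im, ofReal_re, ofReal_im, zero_mul, add_zero]
      rcases ha.eq_or_lt with h | h
      · subst h
        nlinarith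
      · nlinarith
    · simp only [add_im, real_smul, mul_im, ofReal_re, ofReal_im, zero_mul, add_zero]
      rcases ha.eq_or_lt with h | h
      · subst h
        nlinarith
      · nlinarith
  have hTs : {ζ : ℂ | 2 ≤ s * ζ.re ∧ |ζ.im| < 1} ⊆
      {ζ : ℂ | 0 < s * ζ.re ∧ |ζ.im| < 1 ∧ |ζ.im| < normSq ζ} := by
    rintro ζ ⟨h1, h2⟩
    refine ⟨by linarith, h2, h2.trans ?_⟩
    have : (s * ζ.re) * (s * ζ.re) = ζ.re * ζ.re := by linear_combination ζ.re * ζ.re * hs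
    rw [normSq_apply]
    nlinarith [mul_self_nonneg ζ.im]
  have hbase : ((2 * s : ℝ) : ℂ) ∈ {ζ : ℂ | 2 ≤ s * ζ.re ∧ |ζ.im| < 1} := by
    refine ⟨?_, by simp⟩
    rw [ofReal_re]
    nlinarith
  refine isPreconnected_of_forall ((2 * s : ℝ) : ℂ) fun ζ hζ => ?_
  obtain ⟨h1, h2, h3⟩ := hζ
  have hend : ζ + ((2 * s : ℝ) : ℂ) ∈ {ζ : ℂ | 2 ≤ s * ζ.re ∧ |ζ.im| < 1} := by
    refine ⟨?_, by simpa using h2⟩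
    rw [add_re, ofReal_re]
    nlinarith
  refine ⟨segment ℝ ζ (ζ + ((2 * s : ℝ) : ℂ)) ∪ {ζ : ℂ | 2 ≤ s * ζ.re ∧ |ζ.im| < 1},
    Set.union_subset ?_ hTs, Or.inr hbase, Or.inl (left_mem_segment _ _ _),
    IsPreconnected.union _ (right_mem_segment _ _ _) hend
      (convex_segment _ _).isPreconnected hT.isPreconnected⟩
  intro η hη
  rw [segment_eq_image'] at hη
  obtain ⟨θ, ⟨hθ0, -⟩, rfl⟩ := hη
  have hre : (ζ + θ • (ζ + ((2 * s : ℝ) : ℂ) - ζ)).re = ζ.re + θ * (2 * s) := by simp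
  have him : (ζ + θ • (ζ + ((2 * s : ℝ) : ℂ) - ζ)).im = ζ.im := by simp
  refine ⟨?_, by rwa [him], ?_⟩
  · rw [hre]
    nlinarith
  · rw [him]
    refine h3.trans_le ?_
    rw [normSq_apply, normSq_apply, hre, him]
    nlinarith [mul_nonneg hθ0 h1.le, mul_self_nonneg (θ * (2 * s))]

/-- A bounded holomorphic function on the strip `|Im ζ| < 1` whose values at real `t` and `t⁻¹` are
related by `Θ(t⁻¹) = tᵏ conj Θ(t)`, `k ≥ 1`, vanishes at `1`. -/
theorem eq_zero_of_strip_reflection {Θ : ℂ → ℂ} {M : ℝ} {k : ℕ} (hk : k ≠ 0)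
    (hd : DifferentiableOn ℂ Θ {ζ | |ζ.im| < 1}) (hM : ∀ ζ : ℂ, |ζ.im| < 1 → ‖Θ ζ‖ ≤ M)
    (hrefl : ∀ t : ℝ, t ≠ 0 → Θ ((t : ℂ)⁻¹) = (t : ℂ) ^ k * starRingEnd ℂ (Θ t)) : Θ 1 = 0 := by
  let S : Set ℂ := {ζ | |ζ.im| < 1}
  -- V consists of the inverses of the nonzero points of S; S and V together cover ℂ except ±i.
  let V : Set ℂ := {ζ | |ζ.im| < normSq ζ}
  have hSo : IsOpen S := isOpen_lt (by fun_prop) continuous_const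
  have hVo : IsOpen V := isOpen_lt (by fun_prop) Complex.continuous_normSq
  have hM0 : 0 ≤ M := (norm_nonneg _).trans (hM 0 (by simp))
  let Ψ : ℂ → ℂ := fun ζ => (ζ ^ k)⁻¹ * starRingEnd ℂ (Θ (starRingEnd ℂ ζ⁻¹))
  have hV0 : ∀ ζ ∈ V, ζ ≠ 0 := by
    rintro ζ hζ rfl
    simp [V] at hζ
  have hVinv : ∀ ζ ∈ V, |(starRingEnd ℂ ζ⁻¹).im| < 1 := by
    intro ζ hζ
    have h0 : 0 < normSq ζ := normSq_pos.2 (hV0 ζ hζ)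
    rw [conj_im, inv_im, abs_neg, abs_div, abs_neg, abs_of_pos h0, div_lt_one h0]
    exact hζ
  have hΨd : DifferentiableOn ℂ Ψ V := by
    intro ζ hζ
    have h0 := hV0 ζ hζ
    have h1 : DifferentiableAt ℂ Θ (starRingEnd ℂ ζ⁻¹) :=
      hd.differentiableAt (hSo.mem_nhds (hVinv ζ hζ))
    have h2 : DifferentiableAt ℂ (starRingEnd ℂ ∘ Θ ∘ starRingEnd ℂ) ζ⁻¹ := by
      have := h1.conj_conj
      rwa [Complex.conj_conj] at this
    have h3 : DifferentiableAt ℂ (fun ζ => starRingEnd ℂ (Θ (starRingEnd ℂ ζ⁻¹))) ζ :=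
      DifferentiableAt.comp (g := starRingEnd ℂ ∘ Θ ∘ starRingEnd ℂ) ζ h2 (differentiableAt_inv h0)
    have h4 : DifferentiableAt ℂ (fun ζ : ℂ => (ζ ^ k)⁻¹) ζ :=
      DifferentiableAt.fun_inv (by fun_prop) (pow_ne_zero k h0)
    exact (h4.mul h3).differentiableWithinAt
  have hΨM : ∀ ζ ∈ V, ‖Ψ ζ‖ ≤ (‖ζ‖ ^ k)⁻¹ * M := by
    intro ζ hζ
    simp only [Ψ, norm_mul, norm_inv, norm_pow, RCLike.norm_conj]
    gcongr
    exact hM _ (hVinv ζ hζ)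
  have hreal : ∀ t : ℝ, t ≠ 0 → Θ t = Ψ t := by
    intro t ht
    have ht' : (t : ℂ) ≠ 0 := by exact_mod_cast ht
    simp only [Ψ]
    rw [← ofReal_inv, conj_ofReal, ofReal_inv, hrefl t ht, map_mul, map_pow, conj_ofReal,
      Complex.conj_conj, inv_mul_cancel_left₀ (pow_ne_zero k ht')]
  -- S ∩ V misses the imaginary axis and splits into two halves, each containing a real half-axis.
  -- The identity theorem is needed on each, hence the relation for both signs of t.
  have hhalf : ∀ s : ℝ, s * s = 1 → ∀ ζ ∈ S ∩ V, 0 < s * ζ.re → Θ ζ = Ψ ζ := by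
    intro s hs ζ hζ hpos
    have hpre := isPreconnected_half_strip_diff_discs hs
    set D : Set ℂ := {ζ : ℂ | 0 < s * ζ.re ∧ |ζ.im| < 1 ∧ |ζ.im| < normSq ζ}
    have hDo : IsOpen D := by
      have : D = {ζ : ℂ | 0 < s * ζ.re} ∩ (S ∩ V) := rfl
      rw [this]
      exact (isOpen_lt continuous_const (by fun_prop)).inter (hSo.inter hVo)
    have hbase : ((2 * s : ℝ) : ℂ) ∈ D := by
      refine ⟨?_, by simp, ?_⟩
      · rw [ofReal_re]; nlinarith
      · rw [normSq_ofReal, ofReal_im, abs_zero]; nlinarith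
    have hs0 : 2 * s ≠ 0 := by
      rintro h
      have : s = 0 := by linarith
      simp [this] at hs
    refine AnalyticOnNhd.eqOn_of_preconnected_of_frequently_eq
      ((hd.mono fun η hη => hη.2.1).analyticOnNhd hDo)
      ((hΨd.mono fun η hη => hη.2.2).analyticOnNhd hDo) hpre hbase ?_ ⟨hpos, hζ.1, hζ.2⟩
    refine frequently_of_eventually_ofReal ?_
    filter_upwards [isOpen_ne.mem_nhds hs0] with t ht using hreal t ht
  have hSV : ∀ ζ ∈ S ∩ V, Θ ζ = Ψ ζ := by
    intro ζ hζ
    rcases lt_trichotomy ζ.re 0 with h | h | h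
    · exact hhalf (-1) (by norm_num) ζ hζ (by linarith)
    · exfalso
      have h1 : |ζ.im| < 1 := hζ.1
      have h2 : |ζ.im| < normSq ζ := hζ.2
      rw [normSq_apply, h, ← abs_mul_abs_self ζ.im] at h2
      nlinarith [abs_nonneg ζ.im]
    · exact hhalf 1 (by norm_num) ζ hζ (by linarith)
  classical
  let X : ℂ → ℂ := fun ζ => if ζ ∈ S then Θ ζ else Ψ ζ
  have hXS : ∀ ζ ∈ S, X ζ = Θ ζ := fun ζ hζ => if_pos hζ
  have hXV : ∀ ζ ∈ V, X ζ = Ψ ζ := fun ζ hζ => by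
    by_cases h : ζ ∈ S
    · rw [hXS ζ h, hSV ζ ⟨h, hζ⟩]
    · exact if_neg h
  have hcover : ∀ ζ : ℂ, ζ ≠ I → ζ ≠ -I → ζ ∉ S → ζ ∈ V := by
    intro ζ h1 h2 h3
    have h3' : 1 ≤ |ζ.im| := not_lt.1 h3
    change |ζ.im| < normSq ζ
    by_contra h4
    rw [not_lt, normSq_apply, ← abs_mul_abs_self ζ.im] at h4
    have h5 : |ζ.im| = 1 := by nlinarith [mul_self_nonneg ζ.re]
    have h6 : ζ.re = 0 := by
      rw [h5] at h4
      nlinarith [mul_self_nonneg ζ.re]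
    rcases (abs_eq zero_le_one).1 h5 with h7 | h7
    · exact h1 (Complex.ext (by simp [h6]) (by simp [h7]))
    · exact h2 (Complex.ext (by simp [h6]) (by simp [h7]))
  have hXd : ∀ ζ : ℂ, ζ ≠ I → ζ ≠ -I → DifferentiableAt ℂ X ζ := by
    intro ζ h1 h2
    by_cases h3 : ζ ∈ S
    · exact (hd.differentiableAt (hSo.mem_nhds h3)).congr_of_eventuallyEq
        (by filter_upwards [hSo.mem_nhds h3] with η hη using hXS η hη)
    · have h4 := hcover ζ h1 h2 h3
      exact (hΨd.differentiableAt (hVo.mem_nhds h4)).congr_of_eventuallyEq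
        (by filter_upwards [hVo.mem_nhds h4] with η hη using hXV η hη)
  have hXM : ∀ ζ : ℂ, ζ ≠ I → ζ ≠ -I → ‖X ζ‖ ≤ M := by
    intro ζ h1 h2
    by_cases h3 : ζ ∈ S
    · rw [hXS ζ h3]
      exact hM ζ h3
    · rw [hXV ζ (hcover ζ h1 h2 h3)]
      refine (hΨM ζ (hcover ζ h1 h2 h3)).trans ?_
      have h4 : 1 ≤ ‖ζ‖ := (not_lt.1 h3).trans (abs_im_le_norm ζ)
      exact mul_le_of_le_one_left hM0 (inv_le_one_of_one_le₀ (one_le_pow₀ h4))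
  have hII : (I : ℂ) ≠ -I := by
    intro h
    have := congrArg Complex.im h
    norm_num at this
  -- Boundedness makes the singularities I and -I removable, one after the other; Liouville then
  -- makes the result constant.
  let X₁ : ℂ → ℂ := Function.update X I (limUnder (𝓝[≠] I) X)
  have hX₁ : DifferentiableOn ℂ X₁ {-I}ᶜ := by
    refine differentiableOn_update_limUnder_of_bddAbove (isOpen_compl_singleton.mem_nhds hII)
      (fun ζ hζ => (hXd ζ hζ.2 hζ.1).differentiableWithinAt) ⟨M, ?_⟩
    rintro _ ⟨ζ, hζ, rfl⟩
    exact hXM ζ hζ.2 hζ.1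
  have hX₁M : ∀ ζ : ℂ, ζ ≠ -I → ‖X₁ ζ‖ ≤ max M ‖X₁ I‖ := by
    intro ζ hζ
    by_cases h : ζ = I
    · rw [h]
      exact le_max_right _ _
    · have : X₁ ζ = X ζ := Function.update_of_ne h _ _
      rw [this]
      exact (hXM ζ h hζ).trans (le_max_left _ _)
  let X₂ : ℂ → ℂ := Function.update X₁ (-I) (limUnder (𝓝[≠] (-I)) X₁)
  have hX₂ : Differentiable ℂ X₂ := by
    rw [← differentiableOn_univ]
    refine differentiableOn_update_limUnder_of_bddAbove univ_mem (hX₁.mono fun ζ hζ => hζ.2)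
      ⟨max M ‖X₁ I‖, ?_⟩
    rintro _ ⟨ζ, hζ, rfl⟩
    exact hX₁M ζ hζ.2
  have hX₂X : ∀ ζ : ℂ, ζ ≠ I → ζ ≠ -I → X₂ ζ = X ζ := fun ζ h1 h2 =>
    (Function.update_of_ne h2 _ _).trans (Function.update_of_ne h1 _ _)
  have hbdd : Bornology.IsBounded (Set.range X₂) := by
    refine isBounded_iff_forall_norm_le.2 ⟨max (max M ‖X₁ I‖) ‖X₂ (-I)‖, ?_⟩
    rintro _ ⟨ζ, rfl⟩
    by_cases h : ζ = -I
    · rw [h]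
      exact le_max_right _ _
    · have : X₂ ζ = X₁ ζ := Function.update_of_ne h _ _
      rw [this]
      exact (hX₁M ζ h).trans (le_max_left _ _)
  have hone : X₂ 1 = Θ 1 := by
    rw [hX₂X 1, hXS 1 (by simp [S])]
    · intro h
      simpa using congrArg Complex.re h
    · intro h
      simpa using congrArg Complex.re h
  -- The constant is evaluated at (j + 2) i, a point of V other than ±i, where the factor ζ⁻ᵏ forces
  -- decay.
  have hdecay : ∀ j : ℕ, ‖Θ 1‖ ≤ (((j : ℝ) + 2) ^ k)⁻¹ * M := by
    intro j
    have hv : (((j : ℝ) + 2 : ℝ) : ℂ) * I ∈ V := by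
      change |((((j : ℝ) + 2 : ℝ) : ℂ) * I).im| < normSq ((((j : ℝ) + 2 : ℝ) : ℂ) * I)
      rw [im_ofReal_mul, I_im, mul_one, abs_of_pos (by positivity), normSq_mul, normSq_I,
        normSq_ofReal, mul_one]
      nlinarith [(Nat.cast_nonneg j : (0 : ℝ) ≤ j)]
    have h1 : (((j : ℝ) + 2 : ℝ) : ℂ) * I ≠ I := by
      intro h
      have := congrArg Complex.im h
      rw [im_ofReal_mul, I_im, mul_one] at this
      linarith [(Nat.cast_nonneg j : (0 : ℝ) ≤ j)]
    have h2 : (((j : ℝ) + 2 : ℝ) : ℂ) * I ≠ -I := by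
      intro h
      have := congrArg Complex.im h
      rw [im_ofReal_mul, neg_im, I_im, mul_one] at this
      linarith [(Nat.cast_nonneg j : (0 : ℝ) ≤ j)]
    have h3 := hΨM _ hv
    rw [← hXV _ hv, ← hX₂X _ h1 h2, hX₂.apply_eq_apply_of_bounded hbdd _ 1, hone, norm_mul,
      norm_I, mul_one, norm_real, Real.norm_of_nonneg (by positivity)] at h3
    exact h3
  have hlim : Tendsto (fun j : ℕ => (((j : ℝ) + 2) ^ k)⁻¹ * M) atTop (𝓝 0) := by
    have h1 : Tendsto (fun j : ℕ => (j : ℝ) + 2) atTop atTop :=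
      tendsto_atTop_add_const_right _ _ tendsto_natCast_atTop_atTop
    have h2 := (tendsto_inv_atTop_zero.comp ((tendsto_pow_atTop hk).comp h1)).mul_const M
    simpa using h2
  exact norm_le_zero_iff.1 (ge_of_tendsto' hlim hdecay)

end StripReflection

/-! ### Positivity of the squared transform, energy bounds and the dilation argument -/

section SelfConvolution

open FourierTransform RealInnerProductSpace Filter Topology

variable {n : ℕ} {q : EuclideanSpace ℝ (Fin n) → ℂ} {w : EuclideanSpace ℝ (Fin n) → ℝ≥0}

theorem ImageIsBergman.isEntireExtension_fconv_self (himage : ImageIsBergman q w)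
    (hq : Integrable q volume) :
    IsEntireExtension (fconv q q) (fourierLaplace fun ξ => 𝓕 q ξ * 𝓕 q ξ) := by
  have h2 := himage.memLp_fourier hq
  rw [fconv_congr_left (ae_eq_fourierInv_toLp_fourier hq h2)]
  exact (himage.fourierLaplace_mem_and_isEntireExtension hq h2).2

/-- The squared `L²` norm of `ξ ↦ 𝓕 q ξ exp (-2π y·ξ)`. -/
noncomputable def exponentialEnergy (q : EuclideanSpace ℝ (Fin n) → ℂ)
    (y : EuclideanSpace ℝ (Fin n)) : ℝ :=
  ∫ ξ, ‖𝓕 q ξ * planeWave ξ (complexPoint 0 y)‖ ^ 2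

theorem ImageIsBergman.integrable_energy (himage : ImageIsBergman q w)
    (hq : Integrable q volume) (y : EuclideanSpace ℝ (Fin n)) :
    Integrable (fun ξ => ‖𝓕 q ξ * planeWave ξ (complexPoint 0 y)‖ ^ 2) volume :=
  (memLp_fourier_mul_planeWave hq himage.exists_extension _).1.norm.integrable_sq

theorem exponentialEnergy_nonneg (y : EuclideanSpace ℝ (Fin n)) : 0 ≤ exponentialEnergy q y :=
  integral_nonneg fun _ => by positivity

theorem star_fourierInv (h : EuclideanSpace ℝ (Fin n) → ℂ) (x : EuclideanSpace ℝ (Fin n)) :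
    starRingEnd ℂ (𝓕⁻ h (-x)) = 𝓕⁻ (fun ξ => starRingEnd ℂ (h ξ)) x := by
  rw [Real.fourierInv_eq', Real.fourierInv_eq', ← integral_conj]
  refine integral_congr_ae (.of_forall fun ξ => ?_)
  simp only [smul_eq_mul, map_mul, ← Complex.exp_conj, Complex.conj_ofReal, Complex.conj_I,
    inner_neg_right]
  push_cast
  ring_nf

/-- An entire function of one variable that is real on the imaginary axis satisfies
`conj (g (-1)) = g 1`. -/
theorem conj_apply_neg_one_of_real_on_imaginary {g : ℂ → ℂ} (hg : Differentiable ℂ g)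
    (hreal : ∀ t : ℝ, (g (t * Complex.I)).im = 0) : starRingEnd ℂ (g (-1)) = g 1 := by
  let k : ℂ → ℂ := fun ζ => g (ζ * Complex.I)
  have hk : Differentiable ℂ k := hg.comp (by fun_prop)
  let k' : ℂ → ℂ := starRingEnd ℂ ∘ k ∘ starRingEnd ℂ
  have hk' : Differentiable ℂ k' := fun ζ => by
    have := (hk (starRingEnd ℂ ζ)).conj_conj
    rwa [Complex.conj_conj] at this
  have heq : k = k' := by
    refine AnalyticOnNhd.eq_of_frequently_eq (z₀ := ((0 : ℝ) : ℂ)) (fun z _ => hk.analyticAt z)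
      (fun z _ => hk'.analyticAt z) (frequently_of_eventually_ofReal (.of_forall fun t => ?_))
    simp only [k', k, Function.comp, Complex.conj_ofReal]
    exact (Complex.conj_eq_iff_im.2 (hreal t)).symm
  have h1 := congrFun heq (-Complex.I)
  simp only [k', k, Function.comp, map_neg, Complex.conj_I, neg_neg, neg_mul, Complex.I_mul_I]
    at h1
  exact h1.symm

theorem ImageIsBergman.fourier_mul_self_eq (himage : ImageIsBergman q w)
    (hq : Integrable q volume) (hw : Measurable w)
    (hpos : ∀ y : EuclideanSpace ℝ (Fin n),
      (fourierLaplace (fun ξ => 𝓕 q ξ * 𝓕 q ξ) (complexPoint 0 y)).im = 0 ∧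
        0 ≤ (fourierLaplace (fun ξ => 𝓕 q ξ * 𝓕 q ξ) (complexPoint 0 y)).re)
    (ξ : EuclideanSpace ℝ (Fin n)) : 𝓕 q ξ * 𝓕 q ξ = ((‖𝓕 q ξ‖ ^ 2 : ℝ) : ℂ) := by
  have hqc := continuous_fourier_of_integrable hq
  set h : EuclideanSpace ℝ (Fin n) → ℂ := fun ξ => 𝓕 q ξ * 𝓕 q ξ with hh
  have hc : Continuous h := hqc.mul hqc
  have hi : Integrable h volume := himage.integrable_mul_fourier hq (himage.memLp_fourier hq)
  have hent : Differentiable ℂ (fourierLaplace h) := (himage.isEntireExtension_fconv_self hq).1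
  -- Reality on iℝⁿ, used on the complex line through each x, makes the inverse transform of h
  -- Hermitian, so h is real.
  have hsymm : ∀ x : EuclideanSpace ℝ (Fin n), starRingEnd ℂ (𝓕⁻ h (-x)) = 𝓕⁻ h x := by
    intro x
    have := conj_apply_neg_one_of_real_on_imaginary
      (g := fun ζ => fourierLaplace h (ζ • complexPoint x 0)) (hent.comp (by fun_prop)) fun t => by
        rw [smul_complexPoint_zero_right]
        simpa using (hpos (t • x)).1
    rwa [neg_one_smul, one_smul, neg_complexPoint, neg_zero, fourierLaplace_real,
      fourierLaplace_real] at this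
  have hconj : (fun ξ => starRingEnd ℂ (h ξ)) = h := by
    refine (Continuous.ae_eq_iff_eq volume (Complex.continuous_conj.comp hc) hc).1 ?_
    have hic : Integrable (fun ξ => starRingEnd ℂ (h ξ)) volume :=
      (RCLike.conjCLE (K := ℂ)).toContinuousLinearMap.integrable_comp hi
    refine ae_eq_of_fourierInv_eq hic hi ?_
    funext x
    exact (star_fourierInv h x).symm.trans (hsymm x)
  have him : ∀ ξ, (h ξ).im = 0 := fun ξ => Complex.conj_eq_iff_im.1 (congrFun hconj ξ)
  have hofreal : ∀ ξ, h ξ = ((h ξ).re : ℂ) := fun ξ => Complex.ext (by simp) (by simp [him])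
  have hnorm : ∀ ξ, ‖𝓕 q ξ‖ ^ 2 = |(h ξ).re| := fun ξ => by
    rw [← Real.norm_eq_abs, ← Complex.norm_real, ← hofreal, hh, norm_mul, sq]
  suffices hre : ∀ ξ, 0 ≤ (h ξ).re by
    change h ξ = _
    rw [hnorm, abs_of_nonneg (hre ξ)]
    exact hofreal ξ
  have hrec : Continuous fun ξ => (h ξ).re := Complex.continuous_re.comp hc
  by_contra hcon
  push Not at hcon
  obtain ⟨ξ₁, hξ₁⟩ := hcon
  have hG : ∀ ξ, (h ξ).re ≠ 0 → ξ ∈ {ξ | 𝓕 q ξ ≠ 0} := by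
    intro ξ hξ h0
    exact hξ (by simp [hh, h0])
  -- A sign change would produce a zero of h inside the connected set where `𝓕 q` is nonzero. So one
  -- negative value makes h ≤ 0 everywhere, and ∫ h = q * q(0) ≥ 0 then gives h = 0.
  have hneg : ∀ ξ, (h ξ).re ≤ 0 := by
    intro ξ₂
    by_contra hξ₂
    rw [not_le] at hξ₂
    obtain ⟨ξ₃, h3, h4⟩ := (himage.isPreconnected_fourier_ne_zero hq hw).intermediate_value
      (hG ξ₁ hξ₁.ne) (hG ξ₂ hξ₂.ne') hrec.continuousOn ⟨hξ₁.le, hξ₂.le⟩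
    have h5 : h ξ₃ = 0 := by
      rw [hofreal ξ₃, show (h ξ₃).re = 0 from h4, Complex.ofReal_zero]
    exact h3 (mul_self_eq_zero.1 h5)
  have h0 : 0 ≤ ∫ ξ, (h ξ).re := by
    have h1 := (hpos 0).2
    have h2 : complexPoint (0 : EuclideanSpace ℝ (Fin n)) 0 = 0 := by
      ext j
      simp [complexPoint_apply]
    have h3 : fourierLaplace h 0 = ∫ ξ, h ξ := by simp [fourierLaplace, planeWave]
    rw [h2, h3] at h1
    exact h1.trans_eq (integral_re hi).symm
  have hzero : (fun ξ => (h ξ).re) = fun _ => 0 := by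
    refine (Continuous.ae_eq_iff_eq volume hrec continuous_const).1 ?_
    have h1 : ∫ ξ, -(h ξ).re = 0 := by
      refine le_antisymm ?_ (integral_nonneg fun ξ => neg_nonneg.2 (hneg ξ))
      rw [integral_neg]
      linarith
    rw [integral_eq_zero_iff_of_nonneg (fun ξ => neg_nonneg.2 (hneg ξ)) hi.re.neg] at h1
    filter_upwards [h1] with ξ hξ
    simpa using hξ
  exact hξ₁.ne (congrFun hzero ξ₁)

theorem planeWave_two_smul (ξ y : EuclideanSpace ℝ (Fin n)) :
    planeWave ξ (complexPoint 0 ((2 : ℝ) • y)) =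
      ((‖planeWave ξ (complexPoint 0 y)‖ ^ 2 : ℝ) : ℂ) := by
  rw [norm_planeWave, planeWave, complexDot_complexPoint, ← Real.exp_nat_mul, Complex.ofReal_exp]
  congr 1
  rw [inner_smul_right, inner_zero_right]
  push_cast
  linear_combination (4 * Real.pi * ⟪ξ, y⟫ : ℂ) * Complex.I_mul_I

theorem ImageIsBergman.fourierLaplace_mul_self (himage : ImageIsBergman q w)
    (hq : Integrable q volume) (hw : Measurable w)
    (hpos : ∀ y : EuclideanSpace ℝ (Fin n),
      (fourierLaplace (fun ξ => 𝓕 q ξ * 𝓕 q ξ) (complexPoint 0 y)).im = 0 ∧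
        0 ≤ (fourierLaplace (fun ξ => 𝓕 q ξ * 𝓕 q ξ) (complexPoint 0 y)).re)
    (y : EuclideanSpace ℝ (Fin n)) :
    fourierLaplace (fun ξ => 𝓕 q ξ * 𝓕 q ξ) (complexPoint 0 ((2 : ℝ) • y)) =
      exponentialEnergy q y := by
  rw [fourierLaplace, exponentialEnergy, ← integral_complex_ofReal]
  refine integral_congr_ae (.of_forall fun ξ => ?_)
  simp only
  rw [himage.fourier_mul_self_eq hq hw hpos, planeWave_two_smul, norm_mul, mul_pow,
    Complex.ofReal_mul]

/-- Cauchy–Schwarz, the modulus of the plane wave being independent of x. -/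
theorem ImageIsBergman.exists_norm_fourierLaplace_le (himage : ImageIsBergman q w)
    (hq : Integrable q volume) {φ : EuclideanSpace ℝ (Fin n) → ℂ} (hφ : MemLp φ 2 volume) :
    ∃ A : ℝ, 0 ≤ A ∧ ∀ x y : EuclideanSpace ℝ (Fin n),
      ‖fourierLaplace (fun ξ => φ ξ * 𝓕 q ξ) (complexPoint x y)‖ ≤
        A * √(exponentialEnergy q y) := by
  refine ⟨(∫ ξ, ‖φ ξ‖ ^ (2 : ℝ)) ^ (1 / (2 : ℝ)), by positivity, fun x y => ?_⟩
  have hm := (memLp_fourier_mul_planeWave hq himage.exists_extension (complexPoint 0 y)).1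
  have hn : ∀ ξ, ‖planeWave ξ (complexPoint x y)‖ = ‖planeWave ξ (complexPoint 0 y)‖ := fun ξ => by
    rw [norm_planeWave, norm_planeWave]
  calc ‖fourierLaplace (fun ξ => φ ξ * 𝓕 q ξ) (complexPoint x y)‖
      ≤ ∫ ξ, ‖φ ξ * 𝓕 q ξ * planeWave ξ (complexPoint x y)‖ := norm_integral_le_integral_norm _
    _ = ∫ ξ, ‖φ ξ‖ * ‖𝓕 q ξ * planeWave ξ (complexPoint 0 y)‖ := by
        simp only [norm_mul, hn, mul_assoc]
    _ ≤ _ := by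
        refine (integral_mul_norm_le_Lp_mul_Lq Real.HolderConjugate.two_two
          (by simpa using hφ) (by simpa using hm)).trans (le_of_eq ?_)
        congr 1
        rw [Real.sqrt_eq_rpow, exponentialEnergy]
        simp only [Real.rpow_two]

/-- For |b| ≤ 1 the exponential at by is at most the sum of those at y and -y. The energy at -y is
controlled by that at y through |`𝓕 q (-ξ)`| ≤ C |`𝓕 q ξ`|. -/
theorem ImageIsBergman.exists_exponentialEnergy_smul_le (himage : ImageIsBergman q w)
    (hq : Integrable q volume) (hw : Measurable w) (heven : ∀ y, w (-y) = w y) :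
    ∃ C : ℝ, ∀ y : EuclideanSpace ℝ (Fin n), ∀ b : ℝ, |b| ≤ 1 →
      exponentialEnergy q (b • y) ≤ C * exponentialEnergy q y := by
  obtain ⟨C, hC⟩ := himage.exists_fourier_neg_le hq hw heven
  have hneg : ∀ y, exponentialEnergy q (-y) ≤ C ^ 2 * exponentialEnergy q y := by
    intro y
    rw [exponentialEnergy, exponentialEnergy, ← integral_neg_eq_self, ← integral_const_mul]
    refine integral_mono_ae (himage.integrable_energy hq (-y)).comp_neg
      ((himage.integrable_energy hq y).const_mul _) ?_
    filter_upwards [hC] with ξ hξ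
    have h1 : ‖planeWave (-ξ) (complexPoint 0 (-y))‖ = ‖planeWave ξ (complexPoint 0 y)‖ := by
      rw [norm_planeWave, norm_planeWave, inner_neg_neg]
    rw [norm_mul, norm_mul, h1, ← mul_pow, ← mul_assoc]
    exact pow_le_pow_left₀ (by positivity) (mul_le_mul_of_nonneg_right hξ (norm_nonneg _)) 2
  refine ⟨1 + C ^ 2, fun y b hb => ?_⟩
  have hsum : exponentialEnergy q (b • y) ≤ exponentialEnergy q y + exponentialEnergy q (-y) := by
    rw [exponentialEnergy, exponentialEnergy, exponentialEnergy,
      ← integral_add (himage.integrable_energy hq y) (himage.integrable_energy hq (-y))]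
    refine integral_mono (himage.integrable_energy hq _)
      ((himage.integrable_energy hq y).add (himage.integrable_energy hq (-y))) fun ξ => ?_
    have hpw : ‖planeWave ξ (complexPoint 0 (b • y))‖ ^ 2 ≤
        ‖planeWave ξ (complexPoint 0 y)‖ ^ 2 + ‖planeWave ξ (complexPoint 0 (-y))‖ ^ 2 := by
      simp only [norm_planeWave, ← Real.exp_nat_mul, inner_smul_right, inner_neg_right]
      have hb' := abs_le.1 hb
      rcases le_total 0 ⟪ξ, y⟫ with h | h
      · refine le_trans (Real.exp_le_exp.2 ?_) (le_add_of_nonneg_left (Real.exp_nonneg _))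
        have := mul_le_mul_of_nonneg_left (by nlinarith : -(b * ⟪ξ, y⟫) ≤ ⟪ξ, y⟫)
          (by positivity : 0 ≤ 2 * (2 * Real.pi))
        push_cast
        linarith
      · refine le_trans (Real.exp_le_exp.2 ?_) (le_add_of_nonneg_right (Real.exp_nonneg _))
        have := mul_le_mul_of_nonneg_left (by nlinarith : -(b * ⟪ξ, y⟫) ≤ -⟪ξ, y⟫)
          (by positivity : 0 ≤ 2 * (2 * Real.pi))
        push_cast
        linarith
    have := mul_le_mul_of_nonneg_left hpw (sq_nonneg ‖𝓕 q ξ‖)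
    simp only [norm_mul, mul_pow]
    linarith
  linarith [hneg y]

theorem continuous_of_isEntire_real {F : EuclideanSpace ℂ (Fin n) → ℂ} (hF : Differentiable ℂ F) :
    Continuous fun x : EuclideanSpace ℝ (Fin n) => F (complexPoint x 0) :=
  hF.continuous.comp continuous_complexPoint_zero_right

/-- An entire function on `ℂⁿ` with `|F(ax + ibx)| ≤ G(x)` for `|b| < 1`, where `|F| G` is
integrable over `ℝⁿ`, vanishes on `ℝⁿ`. -/
theorem eq_zero_on_real_of_integrable_mul (hn : 0 < n) {F : EuclideanSpace ℂ (Fin n) → ℂ}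
    (hF : Differentiable ℂ F) {G : EuclideanSpace ℝ (Fin n) → ℝ}
    (hG : ∀ x : EuclideanSpace ℝ (Fin n), ∀ ζ : ℂ, |ζ.im| < 1 → ‖F (ζ • complexPoint x 0)‖ ≤ G x)
    (hint : Integrable (fun x => ‖F (complexPoint x 0)‖ * G x) volume)
    (x : EuclideanSpace ℝ (Fin n)) : F (complexPoint x 0) = 0 := by
  have hc := continuous_of_isEntire_real hF
  let f : ℂ → EuclideanSpace ℝ (Fin n) → ℂ := fun ζ x =>
    F (ζ • complexPoint x 0) * starRingEnd ℂ (F (complexPoint x 0))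
  have hfb : ∀ ζ : ℂ, |ζ.im| < 1 → ∀ x, ‖f ζ x‖ ≤ ‖F (complexPoint x 0)‖ * G x := by
    intro ζ hζ x
    rw [norm_mul, RCLike.norm_conj, mul_comm]
    gcongr
    exact hG x ζ hζ
  have hfm : ∀ ζ, Continuous (f ζ) := fun ζ =>
    (hF.continuous.comp (continuous_complexPoint_zero_right.const_smul ζ)).mul
      (Complex.continuous_conj.comp hc)
  let Φ : ℂ → ℂ := fun ζ => ∫ x, f ζ x
  have hΦd : DifferentiableOn ℂ Φ {ζ | |ζ.im| < 1} :=
    differentiableOn_integral_of_dominated (isOpen_lt (by fun_prop) continuous_const)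
      (fun ζ _ => (hfm ζ).aestronglyMeasurable)
      (fun x => ((hF.comp (by fun_prop :
        Differentiable ℂ fun ζ : ℂ => ζ • complexPoint x 0)).mul_const _).differentiableOn)
      hfb hint
  have hΦM : ∀ ζ : ℂ, |ζ.im| < 1 → ‖Φ ζ‖ ≤ ∫ x, ‖F (complexPoint x 0)‖ * G x := fun ζ hζ =>
    norm_integral_le_of_norm_le hint (.of_forall (hfb ζ hζ))
  -- The substitution x ↦ t x exchanges the two factors of the integrand up to conjugation; its
  -- Jacobian is |t|ⁿ.
  have hΦrefl : ∀ t : ℝ, t ≠ 0 → Φ ((t : ℂ)⁻¹) = ((|t| ^ n : ℝ) : ℂ) * starRingEnd ℂ (Φ t) := by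
    intro t ht
    have h1 := Measure.integral_comp_smul (volume : Measure (EuclideanSpace ℝ (Fin n)))
      (f ((t : ℂ)⁻¹)) t
    have h2 : ∀ x, f ((t : ℂ)⁻¹) (t • x) = starRingEnd ℂ (f t x) := by
      intro x
      have h3 : complexPoint (t • x) 0 = (t : ℂ) • complexPoint x 0 := by
        rw [smul_complexPoint_zero_right]
        simp
      simp only [f, h3]
      rw [inv_smul_smul₀ (by exact_mod_cast ht), map_mul, Complex.conj_conj, mul_comm]
    simp only [h2] at h1
    rw [integral_conj, finrank_euclideanSpace_fin, abs_inv, abs_pow] at h1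
    simp only [Φ]
    rw [h1, Complex.real_smul, ← mul_assoc, ← Complex.ofReal_mul,
      mul_inv_cancel₀ (by positivity), Complex.ofReal_one, one_mul]
  -- Squaring replaces |t|ⁿ by t²ⁿ, which is holomorphic in t whatever the parity of n.
  have hΘ := eq_zero_of_strip_reflection (Θ := fun ζ => Φ ζ ^ 2)
    (M := (∫ x, ‖F (complexPoint x 0)‖ * G x) ^ 2) (k := 2 * n) (by omega) (hΦd.pow 2)
    (fun ζ hζ => by
      rw [norm_pow]
      gcongr
      exact hΦM ζ hζ)
    (fun t ht => by
      rw [hΦrefl t ht, mul_pow, ← Complex.ofReal_pow, ← pow_mul, mul_comm n 2, pow_mul |t|,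
        sq_abs, ← pow_mul, map_pow, Complex.ofReal_pow])
  have h1 : Φ 1 = ((∫ x, ‖F (complexPoint x 0)‖ ^ 2 : ℝ) : ℂ) := by
    rw [← integral_complex_ofReal]
    refine integral_congr_ae (.of_forall fun x => ?_)
    simp only [f, one_smul, Complex.mul_conj', Complex.ofReal_pow]
  have hsq : Integrable (fun x => ‖F (complexPoint x 0)‖ ^ 2) volume := by
    refine hint.mono' (hc.norm.pow 2).aestronglyMeasurable (.of_forall fun x => ?_)
    have := hfb 1 (by simp) x
    simpa [f, sq] using this
  have h2 : ∫ x, ‖F (complexPoint x 0)‖ ^ 2 = 0 := by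
    have h3 : Φ 1 = 0 := pow_eq_zero_iff (two_ne_zero) |>.1 hΘ
    rw [h1] at h3
    exact_mod_cast h3
  rw [integral_eq_zero_iff_of_nonneg (fun x => by positivity) hsq] at h2
  have h4 : (fun x => ‖F (complexPoint x 0)‖ ^ 2) = fun _ => 0 :=
    (Continuous.ae_eq_iff_eq volume (hc.norm.pow 2) continuous_const).1 h2
  simpa using congrFun h4 x

end SelfConvolution

/-! ### Conclusion -/

section Uniqueness

open FourierTransform

variable {n : ℕ} {q : EuclideanSpace ℝ (Fin n) → ℂ} {w : EuclideanSpace ℝ (Fin n) → ℝ≥0}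

theorem ImageIsBergman.fconv_ae_eq_zero (himage : ImageIsBergman q w) (hn : 0 < n)
    (hq : Integrable q volume) (hw : Measurable w) (heven : ∀ y, w (-y) = w y)
    {Q : EuclideanSpace ℂ (Fin n) → ℂ} (hQ : IsEntireExtension (fconv q q) Q)
    (hpos : ∀ y : EuclideanSpace ℝ (Fin n), (Q (complexPoint 0 ((2 : ℝ) • y))).im = 0 ∧
      0 ≤ (Q (complexPoint 0 ((2 : ℝ) • y))).re)
    {f : EuclideanSpace ℝ (Fin n) → ℂ} (hf : MemLp f 2 volume)
    (hfin : ∫⁻ y : EuclideanSpace ℝ (Fin n), ‖fconv f q y‖ₑ *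
      ENNReal.ofReal (Real.sqrt (Q (complexPoint 0 ((2 : ℝ) • y))).re) < ∞) :
    fconv f q =ᵐ[volume] 0 := by
  obtain rfl := hQ.unique (himage.isEntireExtension_fconv_self hq)
  set Q := fourierLaplace fun ξ => 𝓕 q ξ * 𝓕 q ξ with hQdef
  have hQP : ∀ y : EuclideanSpace ℝ (Fin n),
      (Q (complexPoint 0 ((2 : ℝ) • y))).re = exponentialEnergy q y := fun y => by
    rw [hQdef, himage.fourierLaplace_mul_self hq hw (fun y => by
      have := hpos ((1 / 2 : ℝ) • y)
      rwa [smul_smul, show (2 * (1 / 2) : ℝ) = 1 by norm_num, one_smul] at this) y,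
      Complex.ofReal_re]
  obtain ⟨F, hFB, hF⟩ := himage.1 f hf
  obtain ⟨φ, hφ, hFφ⟩ := himage.exists_fourierLaplace_eq hq hFB
  obtain ⟨A, hA, hbound⟩ := himage.exists_norm_fourierLaplace_le hq hφ
  obtain ⟨C, hC⟩ := himage.exists_exponentialEnergy_smul_le hq hw heven
  rw [← hFφ] at hbound
  have hPc : Continuous fun y : EuclideanSpace ℝ (Fin n) =>
      √(Q (complexPoint 0 ((2 : ℝ) • y))).re := by
    have h1 : Continuous fun y : EuclideanSpace ℝ (Fin n) => complexPoint 0 ((2 : ℝ) • y) :=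
      continuous_complexPoint.comp (f := fun y : EuclideanSpace ℝ (Fin n) =>
        ((0 : EuclideanSpace ℝ (Fin n)), (2 : ℝ) • y)) (by fun_prop)
    exact (Complex.continuous_re.comp (hQ.1.continuous.comp h1)).sqrt
  have hFc := continuous_of_isEntire_real hF.1
  have hint : Integrable (fun x => ‖F (complexPoint x 0)‖ *
      √(Q (complexPoint 0 ((2 : ℝ) • x))).re) volume := by
    refine ⟨(hFc.norm.mul hPc).aestronglyMeasurable, ?_⟩
    refine lt_of_eq_of_lt (lintegral_congr_ae ?_) hfin
    filter_upwards [hF.2] with x hx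
    rw [enorm_mul, enorm_norm, hx, Real.enorm_of_nonneg (Real.sqrt_nonneg _)]
  have hzero := eq_zero_on_real_of_integrable_mul hn hF.1
    -- The bound on F(ζx) involves only y = (Im ζ) x: A comes from Cauchy–Schwarz and √C from
    -- comparing energies at y and x. The hypothesis on f is exactly integrability of |F| G up to
    -- this constant.
    (G := fun x => A * √C * √(Q (complexPoint 0 ((2 : ℝ) • x))).re)
    (fun x ζ hζ => by
      rw [smul_complexPoint_zero_right]
      refine (hbound _ _).trans ?_
      rw [hQP, mul_assoc, ← Real.sqrt_mul' C (exponentialEnergy_nonneg x)]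
      gcongr
      exact hC x ζ.im hζ.le)
    ((hint.const_mul (A * √C)).congr (.of_forall fun x => by ring))
  filter_upwards [hF.2] with x hx
  rw [← hx, hzero x, Pi.zero_apply]

end Uniqueness

theorem mainTheorem7 (n : ℕ) (hn : 0 < n)
    (q : EuclideanSpace ℝ (Fin n) → ℂ) (hq : Integrable q volume)
    (w : EuclideanSpace ℝ (Fin n) → ℝ≥0) (hw : Measurable w)
    (hrad : ∀ y y' : EuclideanSpace ℝ (Fin n), ‖y‖ = ‖y'‖ → w y = w y')
    (himage : ImageIsBergman q w) :
    (∃ Q : EuclideanSpace ℂ (Fin n) → ℂ, IsEntireExtension (fconv q q) Q) ∧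
    ∀ Q : EuclideanSpace ℂ (Fin n) → ℂ, IsEntireExtension (fconv q q) Q →
      (∀ y : EuclideanSpace ℝ (Fin n),
        (Q (complexPoint 0 ((2 : ℝ) • y))).im = 0 ∧
          0 ≤ (Q (complexPoint 0 ((2 : ℝ) • y))).re) →
      (∀ f : EuclideanSpace ℝ (Fin n) → ℂ, MemLp f 2 volume →
        ∫⁻ y : EuclideanSpace ℝ (Fin n), ‖fconv f q y‖ₑ *
          ENNReal.ofReal (Real.sqrt (Q (complexPoint 0 ((2 : ℝ) • y))).re) < ∞ →
        fconv f q =ᵐ[volume] 0) ∧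
      (TransformInjective q →
        ¬ ∃ f : EuclideanSpace ℝ (Fin n) → ℂ, MemLp f 2 volume ∧ ¬ (f =ᵐ[volume] 0) ∧
          ∫⁻ y : EuclideanSpace ℝ (Fin n), ‖fconv f q y‖ₑ *
            ENNReal.ofReal (Real.sqrt (Q (complexPoint 0 ((2 : ℝ) • y))).re) < ∞) := by

  have heven : ∀ y, w (-y) = w y := fun y => hrad _ _ (norm_neg y)
  refine ⟨⟨_, himage.isEntireExtension_fconv_self hq⟩, fun Q hQ hpos => ⟨fun f hf hfin =>
    himage.fconv_ae_eq_zero hn hq hw heven hQ hpos hf hfin, ?_⟩⟩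
  rintro hinj ⟨f, hf, hne, hfin⟩
  refine hne (hinj f 0 hf MemLp.zero' ?_)
  have h0 : fconv (0 : EuclideanSpace ℝ (Fin n) → ℂ) q = 0 := zero_convolution
  rw [h0]
  exact himage.fconv_ae_eq_zero hn hq hw heven hQ hpos hf hfin
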